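/- Let $K\subset S^3$ be the figure-eight knot and let $\pi_K$ be its knot group, i.e. the fundamental group of the knot exterior (equivalently, of $S^3\setminus K$). For a finitely generated group $G$ and $N\ge 1$ let $R(G,\mathrm{SL}(N,\mathbb{C}))=\mathrm{Hom}(G,\mathrm{SL}(N,\mathbb{C}))$, regarded as an affine algebraic set, and let $X(G,\mathrm{SL}(N,\mathbb{C}))=R(G,\mathrm{SL}(N,\mathbb{C}))/\!\!/\mathrm{SL}(N,\mathbb{C})$ be the character variety, i.e. the algebraic (GIT) quotient by conjugation. The image in $X(G,\mathrm{SL}(N,\mathbb{C}))$ of a representation $\rho\in R(G,\mathrm{SL}(N,\mathbb{C}))$ is called its character; $\rho$ is irreducible if no linear subspace $V$ with $0\neq V\neq\mathbb{C}^N$ is $\rho(G)$-stable. Then for every integer $n\ge 1$ the character variety $X(\pi_K,\mathrm{SL}(10n,\mathbb{C}))$ has an irreducible component $C$ of dimension at least $4n^2-1$ such that $C$ contains characters of irreducible representations $\pi_K\to\mathrm{SL}(10n,\mathbb{C})$. -/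

import Mathlib

/-- The unit `3`-sphere in Euclidean `4`-space. -/
abbrev ThreeSphere : Type := Metric.sphere (0 : EuclideanSpace ℝ (Fin 4)) 1

/-- A closed curve in `ℝ⁴ ∖ {0}`; its radial projection to the unit sphere is a figure-eight knot. -/
noncomputable def figureEightParam (t : ℝ) : EuclideanSpace ℝ (Fin 4) :=
  !₂[Real.cos (2 * t), Real.sin (4 * t), Real.cos (3 * t), Real.sin (3 * t)]

/-- The standard figure-eight knot in the `3`-sphere.

Write a point of `S³ ⊂ ℝ⁴ = ℝ² × ℂ` as `(x, y, w)`. The part `w ≠ 0` is the standard open solid torus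
`ℝ² × S¹` (coordinates `(x, y) / |w|` and `w / |w|`), whose core is an unknot. In these coordinates
the knot is `t ↦ ((cos 2t, sin 4t), e^{3it})`: over each `e^{iθ}` it has three points, which move along
a lemniscate as `θ` varies. It is the closure of the `3`-braid `(σ₁ σ₂⁻¹)²`, that is the curve
`((2 + cos 2t) cos 3t, (2 + cos 2t) sin 3t, sin 4t)` of `ℝ³`. Projecting along `y` gives an
alternating diagram with four crossings. -/
def standardFigureEight : Set ThreeSphere :=
  {p | ∃ t : ℝ, (p : EuclideanSpace ℝ (Fin 4)) = ‖figureEightParam t‖⁻¹ • figureEightParam t}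

/-- A subset of `S³` is a figure-eight knot if a homeomorphism of `S³` carries the standard one onto
it. (The figure-eight knot is isotopic to its mirror image, so orientations play no role.) -/
def IsFigureEightKnot (K : Set ThreeSphere) : Prop :=
  ∃ h : ThreeSphere ≃ₜ ThreeSphere, h '' standardFigureEight = K

/-- The knot group: the fundamental group of the complement of `K` in `S³`, based at `x`. -/
abbrev KnotGroup (K : Set ThreeSphere) (x : ↥(Kᶜ)) : Type := FundamentalGroup ↥(Kᶜ) x

section CharacterVariety

open Matrix

/-- The representation variety `R(G, SL(N, ℂ)) = Hom(G, SL(N, ℂ))`, as a set. -/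
abbrev SLRep (G : Type) [Group G] (N : ℕ) : Type := G →* SpecialLinearGroup (Fin N) ℂ

/-- The action by conjugation: `(A.ρ)(g) = A ρ(g) A⁻¹`. -/
def SLRep.conj {G : Type} [Group G] {N : ℕ} (A : SpecialLinearGroup (Fin N) ℂ) (ρ : SLRep G N) :
    SLRep G N :=
  (MulAut.conj A).toMonoidHom.comp ρ

/-- `ρ` is irreducible: the only `ρ(G)`-stable subspaces of `ℂ^N` are `0` and `ℂ^N`. -/
def SLRep.Irreducible {G : Type} [Group G] {N : ℕ} (ρ : SLRep G N) : Prop :=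
  ∀ V : Submodule ℂ (Fin N → ℂ),
    (∀ g : G, ∀ v ∈ V, (ρ g : Matrix (Fin N) (Fin N) ℂ) *ᵥ v ∈ V) → V = ⊥ ∨ V = ⊤

/-- The coordinate ring of the affine algebraic set `R(G, SL(N, ℂ))`: the functions that are
polynomials in the matrix entries of the `ρ(g)`. If `g₁, …, g_r` generate `G`, these are exactly the
restrictions of the polynomial functions on `M_N(ℂ)^r`, because the entries of `ρ(g)` are polynomials
in the entries of the `ρ(g_k)` (the inverse of a matrix of determinant one is its adjugate). -/
def repCoordinateRing (G : Type) [Group G] (N : ℕ) : Subalgebra ℂ (SLRep G N → ℂ) :=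
  Algebra.adjoin ℂ
    {f | ∃ (g : G) (i j : Fin N), f = fun ρ => (ρ g : Matrix (Fin N) (Fin N) ℂ) i j}

/-- The ring of invariants of the conjugation action on the coordinate ring. -/
def repInvariantRing (G : Type) [Group G] (N : ℕ) : Subalgebra ℂ (SLRep G N → ℂ) where
  carrier := {f | f ∈ repCoordinateRing G N ∧
    ∀ (A : SpecialLinearGroup (Fin N) ℂ) (ρ : SLRep G N), f (ρ.conj A) = f ρ}
  mul_mem' := fun {a b} ha hb =>
    ⟨mul_mem ha.1 hb.1, fun A ρ => by simp only [Pi.mul_apply, ha.2 A ρ, hb.2 A ρ]⟩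
  add_mem' := fun {a b} ha hb =>
    ⟨add_mem ha.1 hb.1, fun A ρ => by simp only [Pi.add_apply, ha.2 A ρ, hb.2 A ρ]⟩
  algebraMap_mem' := fun c => ⟨algebraMap_mem _ c, fun _ _ => rfl⟩

/-- The character variety `X(G, SL(N, ℂ)) = R(G, SL(N, ℂ)) // SL(N, ℂ)`: the algebraic (GIT)
quotient, that is the spectrum of the ring of invariants, with its Zariski topology. -/
abbrev CharacterVariety (G : Type) [Group G] (N : ℕ) : Type :=
  PrimeSpectrum (repInvariantRing G N)

/-- Evaluation of invariant functions at a representation. -/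
def SLRep.evalInvariant {G : Type} [Group G] {N : ℕ} (ρ : SLRep G N) :
    repInvariantRing G N →+* ℂ :=
  (Pi.evalRingHom (fun _ : SLRep G N => ℂ) ρ).comp (repInvariantRing G N).val.toRingHom

/-- The character of `ρ` as a point of the character variety: the image of `ρ` under the quotient
map `R(G, SL(N, ℂ)) → X(G, SL(N, ℂ))`, i.e. the maximal ideal of the invariants vanishing at `ρ`. -/
def SLRep.character {G : Type} [Group G] {N : ℕ} (ρ : SLRep G N) : CharacterVariety G N :=
  ⟨RingHom.ker ρ.evalInvariant, RingHom.ker_isPrime _⟩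

end CharacterVariety

/-! ### Holonomy of a locally constant gauge. -/

section Monodromy

open Topology Set

/-! The figure-eight group acts on a pentagon through the dihedral group of order ten, and the
stabilizer of a vertex, a subgroup of index 5, maps onto a free group on two letters `x`, `q`. Put
`m = 2 * n`. Every pair of matrices in SL(m) thus induces a representation in SL(5m) = SL(10n).
Pairs up to conjugation have `2(m² - 1) - (m² - 1) = 4n² - 1` parameters; it remains to see that
these survive in the character variety of the knot group and that some member of the family is
irreducible.

Topology. No presentation of the knot group is needed, only this: if `U`, `V` in a group `Γ` satisfy
the figure-eight relation, then some homomorphism from the knot group to `Γ` has both in its image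
(`KnotCoordinates.exists_hom`). Label the six regions of the diagram by elements of `Γ` that satisfy
Dehn's relation at each crossing. The complement is covered by the points above the knot, the points
below it, and a box at each crossing; the labels give locally constant transition functions, hence a
covering space with fibre `Γ`, and its monodromy is the homomorphism (`exists_holonomy`). A loop
that descends through one region and returns through another reads off labels.

Algebra. `monomialU` and `monomialV` are explicit 5 by 5 block monomial matrices that satisfy the
relation over any commutative ring (`monomial_relation`). Taking for the ring the entire functions
of `4n² - 1` variables yields a whole analytic family of representations from a single homomorphism.
For a suitable base point the two matrices and their inverses generate the full matrix algebra
(`subalgebra_eq_top_of_monomial`), which gives irreducibility. The directions of the family are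
chosen transversal to simultaneous conjugation of `(x, q)` (`exists_transversal`). The words `V²`
and `VU²V⁻¹` are block diagonal with corners `q` and `x`, so a tangent vector that is a coboundary
upstairs is one for `(x, q)` and vanishes.

Dimension. At a representation that spans the matrix algebra, a cocycle with vanishing traces is a
coboundary (`exists_coboundary_of_trace_eq_zero`). Hence the traces of suitable group elements are
local coordinates on the family. Invariants that vanish on successive coordinate slices form a
strict chain of primes ending at the character of the base point (`exists_component_of_family`); its
length bounds the dimension of a component from below. -/

/-- The bundle with fibre a discrete group glued from a gauge `c` on an open cover. -/
noncomputable def gaugeBundleCore {X Γ ι : Type*} [TopologicalSpace X] [Group Γ]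
    [TopologicalSpace Γ] [DiscreteTopology Γ] (U : ι → Set X) (hU : ∀ i, IsOpen (U i))
    (idx : X → ι) (hidx : ∀ x, x ∈ U (idx x)) (c : ι → X → Γ)
    (hc : ∀ i j, ∀ x ∈ U i ∩ U j, ∀ᶠ y in 𝓝 x, (c j y)⁻¹ * c i y = (c j x)⁻¹ * c i x) :
    FiberBundleCore ι X Γ where
  baseSet := U
  isOpen_baseSet := hU
  indexAt := idx
  mem_baseSet_at := hidx
  coordChange i j x v := (c j x)⁻¹ * c i x * v
  coordChange_self i x _ v := by simp
  continuousOn_coordChange i j := by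
    rintro ⟨x, v⟩ ⟨hx, -⟩
    refine ContinuousAt.continuousWithinAt ?_
    have h : (fun p : X × Γ => (c j x)⁻¹ * c i x * p.2) =ᶠ[𝓝 (x, v)]
        fun p : X × Γ => (c j p.1)⁻¹ * c i p.1 * p.2 := by
      filter_upwards [(continuous_fst.tendsto (x, v)).eventually (hc i j x hx)] with p hp
      rw [hp]
    refine ContinuousAt.congr ?_ h
    exact ((continuous_of_discreteTopology (f := fun v : Γ => (c j x)⁻¹ * c i x * v)).comp
      continuous_snd).continuousAt
  coordChange_comp i j k x _ v := by group

/-- Parallel transport of a locally constant gauge on an open cover. -/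
theorem exists_holonomy {X Γ ι : Type*} [TopologicalSpace X] [Group Γ] (U : ι → Set X)
    (hU : ∀ i, IsOpen (U i)) (hcov : ∀ x, ∃ i, x ∈ U i) (c : ι → X → Γ)
    (hc : ∀ i j, ∀ x ∈ U i ∩ U j, ∀ᶠ y in 𝓝 x, (c j y)⁻¹ * c i y = (c j x)⁻¹ * c i x) :
    ∃ m : ∀ x y : X, Path.Homotopic.Quotient x y → Γ,
      (∀ x, m x x (.refl x) = 1) ∧
      (∀ x y z (γ : Path.Homotopic.Quotient x y) (γ' : Path.Homotopic.Quotient y z),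
        m x z (γ.trans γ') = m y z γ' * m x y γ) ∧
      (∀ x y (γ : Path x y) i, (∀ t, γ t ∈ U i) → m x y (.mk γ) = c i y * (c i x)⁻¹) := by
  let _ : TopologicalSpace Γ := ⊥
  have : DiscreteTopology Γ := ⟨rfl⟩
  choose idx hidx using hcov
  let Z := gaugeBundleCore U hU idx hidx c hc
  have cov : IsCoveringMap Z.proj := FiberBundle.isCoveringMap (F := Γ) (E := Z.Fiber)
  -- `co` is a chart-free, in general discontinuous, fibre coordinate. The coordinate in chart `i`
  -- is `(c i)⁻¹ * co`, so along a continuous lift inside `U i` the value `co` is `c i` times a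
  -- constant on the right.
  let co : Z.TotalSpace → Γ := fun e => c (idx e.1) e.1 * (id e.2 : Γ)
  let pt : ∀ x : X, Γ → Z.TotalSpace := fun x g => ⟨x, (c (idx x) x)⁻¹ * g⟩
  have hco : ∀ x g, co (pt x g) = g := fun x g => mul_inv_cancel_left _ _
  have hpt : ∀ e : Z.TotalSpace, pt e.1 (co e) = e := fun e => by
    change (⟨e.1, (c (idx e.1) e.1)⁻¹ * (c (idx e.1) e.1 * (id e.2 : Γ))⟩ : Z.TotalSpace) = e
    rw [inv_mul_cancel_left]
    rfl
  have lift : ∀ (i : ι) (x y : X) (γ : Path x y), (∀ t, γ t ∈ U i) → ∀ g,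
      Continuous fun t => pt (γ t) (c i (γ t) * g) := by
    intro i x y γ hγ g
    have h := (Z.localTriv i).toOpenPartialHomeomorph.continuousOn_symm
    have h2 : Continuous fun t => ((γ t, g) : X × Γ) := by fun_prop
    have := h.comp_continuous h2 (fun t => by
      rw [show (Z.localTriv i).toOpenPartialHomeomorph.target = _ from (Z.localTriv i).target_eq]
      exact ⟨hγ t, mem_univ _⟩)
    convert this using 2 with t
    change (⟨γ t, (c (idx (γ t)) (γ t))⁻¹ * (c i (γ t) * g)⟩ : Z.TotalSpace) =
      ⟨γ t, (c (idx (γ t)) (γ t))⁻¹ * c i (γ t) * g⟩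
    rw [mul_assoc]
  have trans_cont : ∀ g : Γ, Continuous fun e : Z.TotalSpace => pt e.1 (co e * g) := by
    intro g
    refine continuous_iff_continuousAt.2 fun e => ?_
    have A : Z.baseSet (Z.indexAt e.1) ∈ 𝓝 e.1 :=
      (Z.isOpen_baseSet _).mem_nhds (Z.mem_baseSet_at e.1)
    refine ((Z.localTrivAt e.1).toOpenPartialHomeomorph.continuousAt_iff_continuousAt_comp_left
      ?_).2 ?_
    · exact (Z.continuous_proj.continuousAt (x := e)) A
    · have h1 : ContinuousAt (fun e' => ((Z.localTrivAt e.1) e')) e :=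
        (Z.localTrivAt e.1).toOpenPartialHomeomorph.continuousAt (Z.mem_baseSet_at e.1)
      have h2 : Continuous fun p : X × Γ => (p.1, p.2 * g) :=
        continuous_fst.prodMk
          ((continuous_of_discreteTopology (f := fun v : Γ => v * g)).comp continuous_snd)
      refine (h2.continuousAt.comp h1).congr (Filter.Eventually.of_forall fun e' => ?_)
      change (e'.1, (c (idx e.1) e'.1)⁻¹ * c (idx e'.1) e'.1 * (id e'.2 : Γ) * g) =
        (e'.1, (c (idx e.1) e'.1)⁻¹ * c (idx e'.1) e'.1 *
          ((c (idx e'.1) e'.1)⁻¹ * (c (idx e'.1) e'.1 * (id e'.2 : Γ) * g)))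
      simp only [mul_assoc, mul_inv_cancel_left]
  -- Transition functions multiply on the left, so right multiplication acts by deck transformations
  -- and carries lifts to lifts. Transport is therefore left multiplication by the image of `1`.
  have equiv : ∀ x y (γ : Path.Homotopic.Quotient x y) (g h : Γ),
      co (cov.monodromy γ ⟨pt x (g * h), rfl⟩).1 = co (cov.monodromy γ ⟨pt x g, rfl⟩).1 * h := by
    intro x y γ g h
    obtain ⟨γ⟩ := γ
    change co (cov.liftPath γ (pt x (g * h)) _ 1) = co (cov.liftPath γ (pt x g) _ 1) * h
    have h0 : (γ : C(unitInterval, X)) 0 = Z.proj (pt x (g * h)) := γ.source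
    have h1 : (γ : C(unitInterval, X)) 0 = Z.proj (pt x g) := γ.source
    let Γ' : C(unitInterval, Z.TotalSpace) :=
      ⟨fun t => pt (cov.liftPath γ (pt x g) h1 t).1 (co (cov.liftPath γ (pt x g) h1 t) * h),
        (trans_cont h).comp (cov.liftPath γ (pt x g) h1).continuous⟩
    have : Γ' = cov.liftPath γ (pt x (g * h)) h0 := by
      rw [cov.eq_liftPath_iff']
      refine ⟨?_, ?_⟩
      · ext t
        exact congr_fun (cov.liftPath_lifts γ (pt x g) h1) t
      · change pt (cov.liftPath γ (pt x g) h1 0).1 (co (cov.liftPath γ (pt x g) h1 0) * h) = _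
        rw [cov.liftPath_zero, hco]
    rw [← this]
    exact hco _ _
  refine ⟨fun x y γ => co (cov.monodromy γ ⟨pt x 1, rfl⟩).1, ?_, ?_, ?_⟩
  · intro x
    simp only [cov.monodromy_refl, id]
    exact hco _ _
  · intro x y z γ γ'
    simp only [cov.monodromy_trans_apply]
    have : ∀ e : Z.proj ⁻¹' {y}, e = ⟨pt y (1 * co e.1), rfl⟩ := by
      rintro ⟨e, rfl⟩
      exact Subtype.ext (by simp [hpt])
    rw [this (cov.monodromy γ ⟨pt x 1, rfl⟩), equiv, one_mul, hco]
  · intro x y γ i hγ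
    change co (cov.liftPath γ (pt x 1) _ 1) = _
    have h0 : (γ : C(unitInterval, X)) 0 = Z.proj (pt x 1) := γ.source
    let Γ' : C(unitInterval, Z.TotalSpace) :=
      ⟨fun t => pt (γ t) (c i (γ t) * (c i x)⁻¹), lift i x y γ hγ _⟩
    have : Γ' = cov.liftPath γ (pt x 1) h0 := by
      rw [cov.eq_liftPath_iff']
      refine ⟨rfl, ?_⟩
      change pt (γ 0) (c i (γ 0) * (c i x)⁻¹) = _
      rw [γ.source, mul_inv_cancel]
    rw [← this]
    change co (pt (γ 1) _) = _
    rw [hco, γ.target]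

end Monodromy

/-! ### The knot diagram: regions, symmetry and labels. -/

section Diagram

open Topology Set

/-- Coordinates `(x, y, a, b)` of `ℝ⁴ = ℝ × ℝ × ℂ`; the knot is projected along `y`. -/
abbrev Coords : Type := ℝ × ℝ × ℝ × ℝ

namespace Coords

/-- The modulus of the complex coordinate. -/
noncomputable def rad (q : Coords) : ℝ := √(q.2.2.1 ^ 2 + q.2.2.2 ^ 2)

/-- The point lies over the point of the knot diagram with parameter `t`. -/
def Over (q : Coords) (t : ℝ) : Prop :=
  q.1 = q.rad * Real.cos (2 * t) ∧ q.2.2.1 = q.rad * Real.cos (3 * t) ∧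
    q.2.2.2 = q.rad * Real.sin (3 * t)

/-- The points above all strands of the knot. -/
def top : Set Coords := {q | ∀ t, q.Over t → q.rad * Real.sin (4 * t) < q.2.1}

/-- The points below all strands of the knot. -/
def bot : Set Coords := {q | ∀ t, q.Over t → q.2.1 < q.rad * Real.sin (4 * t)}

/-- The points which lie on no strand of the knot. -/
def offKnot : Set Coords := {q | ∀ t, q.Over t → q.2.1 ≠ q.rad * Real.sin (4 * t)}

/-- The symmetry of order four of the knot. -/
def rot (q : Coords) : Coords := (-q.1, q.2.1, q.2.2.2, -q.2.2.1)

/-- A function whose zero set is the cone over the knot diagram. -/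
noncomputable def disc (q : Coords) : ℝ :=
  q.rad * (q.2.2.1 ^ 2 - q.2.2.2 ^ 2) - 4 * q.1 ^ 3 + 3 * q.1 * q.rad ^ 2

/-- The label of the region of the diagram which contains `q`. -/
noncomputable def label {Γ : Type*} (w e p m u v : Γ) (q : Coords) : Γ :=
  open scoped Classical in
  if 0 < q.disc then (if 2 * q.1 < -q.rad then w else if 0 < q.2.2.1 then p else m)
  else (if q.rad < 2 * q.1 then e else if 0 < q.2.2.2 then u else v)

/-- The argument of the complex coordinate. -/
noncomputable def angle (q : Coords) : ℝ := Complex.arg ⟨q.2.2.1, q.2.2.2⟩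

/-- The `x`-coordinate of the over-strand at the crossing with angle `0`. -/
noncomputable def overX (q : Coords) : ℝ := q.rad * Real.cos (2 * (2 * Real.pi / 3 + q.angle / 3))

/-- The `x`-coordinate of the under-strand at the crossing with angle `0`. -/
noncomputable def underX (q : Coords) : ℝ :=
  q.rad * Real.cos (2 * (-(2 * Real.pi / 3) + q.angle / 3))

/-- A neighbourhood of the segment between the two strands of the crossing with angle `0`. -/
def mid : Set Coords :=
  {q | |q.2.2.2| < q.2.2.1 ∧ -q.rad < q.1 ∧ q.1 < 0 ∧
    (q.1 = q.overX → q.2.1 < q.rad * Real.sin (4 * (2 * Real.pi / 3 + q.angle / 3))) ∧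
    (q.1 = q.underX → q.rad * Real.sin (4 * (-(2 * Real.pi / 3) + q.angle / 3)) < q.2.1)}

@[fun_prop]
theorem continuous_rad : Continuous rad := by unfold rad; fun_prop

@[fun_prop]
theorem continuous_disc : Continuous disc := by unfold disc; fun_prop

theorem rad_nonneg (q : Coords) : 0 ≤ q.rad := Real.sqrt_nonneg _

theorem rad_sq (q : Coords) : q.rad ^ 2 = q.2.2.1 ^ 2 + q.2.2.2 ^ 2 :=
  Real.sq_sqrt (by positivity)

@[simp] theorem rad_rot (q : Coords) : q.rot.rad = q.rad := by
  simp [rad, rot, add_comm]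

@[fun_prop]
theorem continuous_rot : Continuous rot := by unfold rot; fun_prop

theorem disc_rot (q : Coords) : q.rot.disc = -q.disc := by
  simp only [disc, rad_rot]; simp only [rot]; ring

theorem Over.of_rot {q : Coords} {t : ℝ} (h : q.rot.Over t) : q.Over (t - Real.pi / 2) := by
  obtain ⟨h1, h2, h3⟩ := h
  simp only [rad_rot] at h1 h2 h3
  simp only [rot] at h1 h2 h3
  have e1 : Real.cos (2 * (t - Real.pi / 2)) = -Real.cos (2 * t) := by
    rw [← Real.cos_sub_pi]; ring_nf
  have e2 : Real.cos (3 * (t - Real.pi / 2)) = -Real.sin (3 * t) := by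
    rw [show 3 * (t - Real.pi / 2) = 3 * t + Real.pi / 2 - 2 * Real.pi by ring, Real.cos_sub_two_pi,
      Real.cos_add_pi_div_two]
  have e3 : Real.sin (3 * (t - Real.pi / 2)) = Real.cos (3 * t) := by
    rw [show 3 * (t - Real.pi / 2) = 3 * t + Real.pi / 2 - 2 * Real.pi by ring, Real.sin_sub_two_pi,
      Real.sin_add_pi_div_two]
  refine ⟨?_, ?_, ?_⟩
  · rw [e1]; linarith
  · rw [e2]; linarith
  · rw [e3]; linarith

theorem Over.rot {q : Coords} {t : ℝ} (h : q.Over t) : q.rot.Over (t + Real.pi / 2) := by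
  obtain ⟨h1, h2, h3⟩ := h
  have e1 : Real.cos (2 * (t + Real.pi / 2)) = -Real.cos (2 * t) := by
    rw [← Real.cos_add_pi]; ring_nf
  have e2 : Real.cos (3 * (t + Real.pi / 2)) = Real.sin (3 * t) := by
    rw [show 3 * (t + Real.pi / 2) = 3 * t - Real.pi / 2 + 2 * Real.pi by ring, Real.cos_add_two_pi,
      Real.cos_sub_pi_div_two]
  have e3 : Real.sin (3 * (t + Real.pi / 2)) = -Real.cos (3 * t) := by
    rw [show 3 * (t + Real.pi / 2) = 3 * t - Real.pi / 2 + 2 * Real.pi by ring, Real.sin_add_two_pi,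
      Real.sin_sub_pi_div_two]
  refine ⟨?_, ?_, ?_⟩ <;> simp only [rad_rot] <;> simp only [Coords.rot]
  · rw [e1]; linarith
  · rw [e2]; linarith
  · rw [e3]; linarith

theorem sin_four_mul_sub_pi_div_two (t : ℝ) :
    Real.sin (4 * (t - Real.pi / 2)) = Real.sin (4 * t) := by
  rw [← Real.sin_sub_two_pi (4 * t)]; ring_nf

theorem rot_mem_top {q : Coords} (h : q ∈ top) : q.rot ∈ top := by
  intro t ht
  have := h _ ht.of_rot
  rw [sin_four_mul_sub_pi_div_two] at this
  rwa [rad_rot]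

theorem rot_mem_bot {q : Coords} (h : q ∈ bot) : q.rot ∈ bot := by
  intro t ht
  have := h _ ht.of_rot
  rw [sin_four_mul_sub_pi_div_two] at this
  rwa [rad_rot]

theorem rot_rot_rot_rot (q : Coords) : q.rot.rot.rot.rot = q := by
  simp [rot]

theorem Over.congr {q : Coords} {t : ℝ} (h : q.Over t) (k : ℤ) :
    q.Over (t + k * (2 * Real.pi)) := by
  obtain ⟨h1, h2, h3⟩ := h
  refine ⟨?_, ?_, ?_⟩
  · rw [show 2 * (t + k * (2 * Real.pi)) = 2 * t + (2 * k : ℤ) * (2 * Real.pi) by push_cast; ring,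
      Real.cos_add_int_mul_two_pi]; exact h1
  · rw [show 3 * (t + k * (2 * Real.pi)) = 3 * t + (3 * k : ℤ) * (2 * Real.pi) by push_cast; ring,
      Real.cos_add_int_mul_two_pi]; exact h2
  · rw [show 3 * (t + k * (2 * Real.pi)) = 3 * t + (3 * k : ℤ) * (2 * Real.pi) by push_cast; ring,
      Real.sin_add_int_mul_two_pi]; exact h3

theorem sin_four_mul_add_int_mul (t : ℝ) (k : ℤ) :
    Real.sin (4 * (t + k * (2 * Real.pi))) = Real.sin (4 * t) := by
  rw [show 4 * (t + k * (2 * Real.pi)) = 4 * t + (4 * k : ℤ) * (2 * Real.pi) by push_cast; ring,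
    Real.sin_add_int_mul_two_pi]

theorem exists_mem_Icc (t : ℝ) : ∃ k : ℤ, t + k * (2 * Real.pi) ∈ Icc 0 (2 * Real.pi) := by
  refine ⟨-toIcoDiv Real.two_pi_pos 0 t, ?_⟩
  have := toIcoMod_mem_Ico Real.two_pi_pos 0 t
  rw [toIcoMod, zero_add, zsmul_eq_mul] at this
  push_cast
  constructor <;> nlinarith [this.1, this.2]

/-- The parameter ranges over a compact interval, and projection along a compact factor is closed.
This makes `top` and `bot` open. -/
theorem isClosed_exists_over {S : Set (ℝ × Coords)} (hS : IsClosed S) :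
    IsClosed {q : Coords | ∃ t ∈ Icc 0 (2 * Real.pi), q.Over t ∧ (t, q) ∈ S} := by
  let Z : Set (Icc 0 (2 * Real.pi) × Coords) := {z | z.2.Over z.1 ∧ ((z.1 : ℝ), z.2) ∈ S}
  have hZ : IsClosed Z := by
    refine IsClosed.inter ?_ (hS.preimage (f := fun z : Icc 0 (2 * Real.pi) × Coords =>
      ((z.1 : ℝ), z.2)) (by fun_prop))
    refine IsClosed.inter ?_ (IsClosed.inter ?_ ?_)
    · exact isClosed_eq (by fun_prop) (by fun_prop)
    · exact isClosed_eq (by fun_prop) (by fun_prop)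
    · exact isClosed_eq (by fun_prop) (by fun_prop)
  convert isClosedMap_snd_of_compactSpace Z hZ using 1
  ext q
  constructor
  · rintro ⟨t, ht, h1, h2⟩
    exact ⟨(⟨t, ht⟩, q), ⟨h1, h2⟩, rfl⟩
  · rintro ⟨⟨t, q'⟩, ⟨h1, h2⟩, rfl⟩
    exact ⟨t, t.2, h1, h2⟩

theorem isOpen_top : IsOpen top := by
  rw [← isClosed_compl_iff]
  convert isClosed_exists_over (S := {z | z.2.2.1 ≤ z.2.rad * Real.sin (4 * z.1)})
    (isClosed_le (by fun_prop) (by fun_prop)) using 1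
  ext q
  simp only [top, mem_compl_iff, mem_ofPred_eq, not_forall, not_lt]
  constructor
  · rintro ⟨t, ht, h⟩
    obtain ⟨k, hk⟩ := exists_mem_Icc t
    exact ⟨_, hk, ht.congr k, by rwa [sin_four_mul_add_int_mul]⟩
  · rintro ⟨t, -, ht, h⟩
    exact ⟨t, ht, h⟩

theorem isOpen_bot : IsOpen bot := by
  rw [← isClosed_compl_iff]
  convert isClosed_exists_over (S := {z | z.2.rad * Real.sin (4 * z.1) ≤ z.2.2.1})
    (isClosed_le (by fun_prop) (by fun_prop)) using 1
  ext q
  simp only [bot, mem_compl_iff, mem_ofPred_eq, not_forall, not_lt]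
  constructor
  · rintro ⟨t, ht, h⟩
    obtain ⟨k, hk⟩ := exists_mem_Icc t
    exact ⟨_, hk, ht.congr k, by rwa [sin_four_mul_add_int_mul]⟩
  · rintro ⟨t, -, ht, h⟩
    exact ⟨t, ht, h⟩

/-- Away from the axis, `disc` is `rad³` times `cos 2θ - T₃(x / rad)`, with `T₃` the Chebyshev
polynomial. On the diagram both terms are `cos 6t`. -/
theorem Over.disc_eq_zero {q : Coords} {t : ℝ} (h : q.Over t) : q.disc = 0 := by
  obtain ⟨h1, h2, h3⟩ := h
  have e1 : Real.cos (2 * (3 * t)) = Real.cos (3 * (2 * t)) := by ring_nf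
  rw [Real.cos_two_mul', Real.cos_three_mul (2 * t)] at e1
  simp only [disc]
  rw [h1, h2, h3]
  linear_combination q.rad ^ 3 * e1

/-- Every zero of `disc` other than the poles lies over a point of the diagram. -/
theorem exists_over {q : Coords} (h : q.disc = 0) : ∃ t, q.Over t := by
  rcases (rad_nonneg q).eq_or_lt with hr | hr
  · refine ⟨0, ?_, ?_, ?_⟩
    · rw [disc, ← hr] at h
      have : q.1 ^ 3 = 0 := by linarith
      rw [← hr, zero_mul]
      exact pow_eq_zero_iff (by norm_num) |>.1 this
    all_goals
      have := rad_sq q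
      rw [← hr] at this ⊢
      nlinarith [sq_nonneg q.2.2.1, sq_nonneg q.2.2.2]
  · set z : ℂ := ⟨q.2.2.1, q.2.2.2⟩ with hz
    have hn : ‖z‖ = q.rad := by
      rw [Complex.norm_def, Complex.normSq_apply, rad]; congr 1; simp [hz]; ring
    have ha : q.2.2.1 = q.rad * Real.cos q.angle := by
      rw [← hn]; exact (Complex.norm_mul_cos_arg z).symm
    have hb : q.2.2.2 = q.rad * Real.sin q.angle := by
      rw [← hn]; exact (Complex.norm_mul_sin_arg z).symm
    obtain ⟨w, hw⟩ : ∃ w, q.1 = q.rad * w := ⟨q.1 / q.rad, by field_simp⟩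
    have key : Real.cos (2 * q.angle) = 4 * w ^ 3 - 3 * w := by
      rw [disc, ha, hb, hw] at h
      have : q.rad ^ 3 * (Real.cos (2 * q.angle) - (4 * w ^ 3 - 3 * w)) = 0 := by
        rw [Real.cos_two_mul']; linear_combination h
      rcases mul_eq_zero.1 this with h | h
      · exact absurd h (by positivity)
      · linarith
    -- The bounds on `w` follow from `4w³ - 3w + 1 = (w + 1)(2w - 1)²` and `4w³ - 3w - 1 = (w -
    -- 1)(2w + 1)²`.
    have h1 : -1 ≤ w := by
      by_contra hh
      push Not at hh
      have := Real.neg_one_le_cos (2 * q.angle)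
      nlinarith [mul_pos (show 0 < -(w + 1) by linarith)
        (pow_pos (show 0 < -(2 * w - 1) by linarith) 2)]
    have h2 : w ≤ 1 := by
      by_contra hh
      push Not at hh
      have := Real.cos_le_one (2 * q.angle)
      nlinarith [mul_pos (show 0 < w - 1 by linarith)
        (pow_pos (show 0 < 2 * w + 1 by linarith) 2)]
    have h3 : Real.cos (2 * q.angle) = Real.cos (3 * Real.arccos w) := by
      rw [Real.cos_three_mul, Real.cos_arccos h1 h2, key]
    obtain ⟨k, hk⟩ := Real.cos_eq_cos_iff.1 h3
    -- The sign `ε` treats both solutions of the cosine equation at once. The parameter is chosen so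
    -- that `2t = ± arccos w` and `3t = angle`, each modulo `2π`.
    have main : ∀ ε : ℝ, ε = 1 ∨ ε = -1 →
        3 * Real.arccos w = 2 * k * Real.pi + ε * (2 * q.angle) → ∃ t, q.Over t := by
      intro ε hε hk
      refine ⟨ε * (Real.arccos w / 2) - ε * (k * Real.pi), ?_, ?_, ?_⟩
      · rw [hw]
        congr 1
        rcases hε with rfl | rfl
        · rw [show 2 * (1 * (Real.arccos w / 2) - 1 * (k * Real.pi)) =
            Real.arccos w - k * (2 * Real.pi) by ring, Real.cos_sub_int_mul_two_pi,
            Real.cos_arccos h1 h2]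
        · rw [show 2 * (-1 * (Real.arccos w / 2) - -1 * (k * Real.pi)) =
            -(Real.arccos w - k * (2 * Real.pi)) by ring, Real.cos_neg,
            Real.cos_sub_int_mul_two_pi, Real.cos_arccos h1 h2]
      all_goals
        have e : 3 * (ε * (Real.arccos w / 2) - ε * (k * Real.pi)) =
            q.angle + (if ε = 1 then -k else k : ℤ) * (2 * Real.pi) := by
          rcases hε with rfl | rfl
          · simp only [if_true]; push_cast; linarith
          · norm_num; linarith
        rw [e]
      · rw [Real.cos_add_int_mul_two_pi]; exact ha
      · rw [Real.sin_add_int_mul_two_pi]; exact hb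
    rcases hk with hk | hk
    · exact main 1 (.inl rfl) (by rw [hk]; ring)
    · exact main (-1) (.inr rfl) (by rw [hk]; ring)

/-- A zero of `disc` lies over a strand and cannot be both above and below it. With the two lemmas
that follow, `top ∩ bot` is exactly the complement of the cone over the diagram. -/
theorem disc_ne_zero {q : Coords} (h1 : q ∈ top) (h2 : q ∈ bot) : q.disc ≠ 0 := by
  intro h
  obtain ⟨t, ht⟩ := exists_over h
  exact lt_asymm (h1 t ht) (h2 t ht)

theorem mem_top_of_disc_ne_zero {q : Coords} (h : q.disc ≠ 0) : q ∈ top :=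
  fun _ ht => absurd ht.disc_eq_zero h

theorem mem_bot_of_disc_ne_zero {q : Coords} (h : q.disc ≠ 0) : q ∈ bot :=
  fun _ ht => absurd ht.disc_eq_zero h

/-- On this locus `disc = -2 * rad * b² ≤ 0`, with `b` the last coordinate. So it separates the
western region from the other two regions of its colour. -/
theorem two_mul_fst_ne_of_disc_pos {q : Coords} (h : 0 < q.disc) : 2 * q.1 ≠ -q.rad := by
  intro h0
  have e := rad_sq q
  have : q.disc = -2 * q.rad * q.2.2.2 ^ 2 := by
    rw [disc]
    have h1 : q.1 = -q.rad / 2 := by linarith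
    rw [h1]
    linear_combination -q.rad * e
  nlinarith [rad_nonneg q, sq_nonneg q.2.2.2, mul_nonneg (rad_nonneg q) (sq_nonneg q.2.2.2)]

/-- For vanishing third coordinate `disc = -(x + rad)(2x - rad)²`, so positivity forces `x < -rad`.
Hence the sign of that coordinate tells `p` from `m`, without ties, outside the western region. -/
theorem two_mul_fst_lt_of_disc_pos {q : Coords} (h : 0 < q.disc) (h0 : q.2.2.1 = 0) :
    2 * q.1 < -q.rad := by
  have e := rad_sq q
  rw [h0] at e
  have e2 : q.disc = -(q.1 + q.rad) * (2 * q.1 - q.rad) ^ 2 := by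
    rw [disc, h0]
    linear_combination q.rad * e
  have h1 : q.1 + q.rad < 0 := by
    by_contra hh
    push Not at hh
    nlinarith [mul_nonneg hh (sq_nonneg (2 * q.1 - q.rad))]
  linarith [rad_nonneg q]

theorem label_rot {Γ : Type*} (w e p m u v : Γ) {q : Coords} (h : q.disc ≠ 0) :
    label w e p m u v q.rot = label e w v u p m q := by
  rcases lt_or_gt_of_ne h with h | h
  · have h1 : 0 < q.rot.disc := by rw [disc_rot]; linarith
    have e1 : q.rot.2.2.1 = q.2.2.2 := rfl
    have e2 : q.rot.1 = -q.1 := rfl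
    simp only [label, if_pos h1, if_neg (not_lt.2 h.le), e1, e2, rad_rot]
    congr 1
    exact propext ⟨fun h => by linarith, fun h => by linarith⟩
  · have h1 : ¬ 0 < q.rot.disc := by rw [disc_rot]; linarith
    have e1 : q.rot.2.2.2 = -q.2.2.1 := rfl
    have e2 : q.rot.1 = -q.1 := rfl
    simp only [label, if_neg h1, if_pos h, e1, e2, rad_rot]
    by_cases hc : 2 * q.1 < -q.rad
    · rw [if_pos hc, if_pos (by linarith)]
    · rw [if_neg hc, if_neg (by linarith)]
      by_cases ha : 0 < q.2.2.1
      · rw [if_pos ha, if_neg (by linarith)]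
      · rw [if_neg ha, if_pos]
        -- `label` sends the tie to its last branch, which the rotation does not respect; a tie
        -- cannot occur here.
        have := fun h0 => hc (two_mul_fst_lt_of_disc_pos h h0)
        have := lt_of_le_of_ne (not_lt.1 ha) this
        linarith

theorem eventually_label_of_disc_pos {Γ : Type*} (w e p m u v : Γ) {q : Coords}
    (h : 0 < q.disc) : ∀ᶠ q' in 𝓝 q, label w e p m u v q' = label w e p m u v q := by
  have hd : ∀ᶠ q' in 𝓝 q, 0 < disc q' := continuous_disc.continuousAt.eventually_const_lt h
  rcases lt_or_gt_of_ne (two_mul_fst_ne_of_disc_pos h) with h1 | h1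
  · have : ∀ᶠ q' : Coords in 𝓝 q, 2 * q'.1 < -q'.rad :=
      (isOpen_lt (f := fun q' : Coords => 2 * q'.1) (g := fun q' => -q'.rad)
        (by fun_prop) (by fun_prop)).mem_nhds h1
    filter_upwards [hd, this] with q' h2 h3
    simp only [label, if_pos h, if_pos h2, if_pos h1, if_pos h3]
  · have : ∀ᶠ q' : Coords in 𝓝 q, -q'.rad < 2 * q'.1 :=
      (isOpen_lt (f := fun q' : Coords => -q'.rad) (g := fun q' => 2 * q'.1)
        (by fun_prop) (by fun_prop)).mem_nhds h1
    have h0 : q.2.2.1 ≠ 0 := fun h0 => by linarith [two_mul_fst_lt_of_disc_pos h h0]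
    rcases lt_or_gt_of_ne h0 with h4 | h4
    · have h5 : ∀ᶠ q' : Coords in 𝓝 q, q'.2.2.1 < 0 :=
        (isOpen_lt (f := fun q' : Coords => q'.2.2.1) (g := fun _ => 0)
          (by fun_prop) (by fun_prop)).mem_nhds h4
      filter_upwards [hd, this, h5] with q' h2 h3 h6
      simp only [label, if_pos h, if_pos h2, if_neg (not_lt.2 h1.le), if_neg (not_lt.2 h3.le),
        if_neg (not_lt.2 h4.le), if_neg (not_lt.2 h6.le)]
    · have h5 : ∀ᶠ q' : Coords in 𝓝 q, 0 < q'.2.2.1 :=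
        (isOpen_lt (f := fun q' : Coords => (0 : ℝ)) (g := fun q' => q'.2.2.1)
          (by fun_prop) (by fun_prop)).mem_nhds h4
      filter_upwards [hd, this, h5] with q' h2 h3 h6
      simp only [label, if_pos h, if_pos h2, if_neg (not_lt.2 h1.le), if_neg (not_lt.2 h3.le),
        if_pos h4, if_pos h6]

theorem eventually_label {Γ : Type*} (w e p m u v : Γ) {q : Coords}
    (h : q.disc ≠ 0) : ∀ᶠ q' in 𝓝 q, label w e p m u v q' = label w e p m u v q := by
  rcases lt_or_gt_of_ne h with h1 | h1
  · have h2 : 0 < q.rot.disc := by rw [disc_rot]; linarith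
    have h3 := continuous_rot.continuousAt.eventually
      (eventually_label_of_disc_pos e w u v m p h2)
    filter_upwards [h3, continuous_disc.continuousAt.eventually_ne h] with q' h4 h5
    rwa [label_rot _ _ _ _ _ _ h, label_rot _ _ _ _ _ _ h5] at h4
  · exact eventually_label_of_disc_pos w e p m u v h1

end Coords

end Diagram

/-! ### Gauges near a crossing. -/

section Diagram

open Topology Set

namespace Coords

theorem re_im_eq (q : Coords) :
    q.2.2.1 = q.rad * Real.cos q.angle ∧ q.2.2.2 = q.rad * Real.sin q.angle := by
  set z : ℂ := ⟨q.2.2.1, q.2.2.2⟩ with hz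
  have hn : ‖z‖ = q.rad := by
    rw [Complex.norm_def, Complex.normSq_apply, rad]; congr 1; simp [hz]; ring
  rw [← hn]
  exact ⟨(Complex.norm_mul_cos_arg z).symm, (Complex.norm_mul_sin_arg z).symm⟩

theorem rad_pos {q : Coords} (h : 0 < q.2.2.1) : 0 < q.rad :=
  Real.sqrt_pos.2 (by positivity)

theorem abs_angle_lt {q : Coords} (h : 0 < q.2.2.1) : |q.angle| < Real.pi / 2 :=
  Complex.abs_arg_lt_pi_div_two_iff.2 (.inl h)

theorem continuousAt_angle {q : Coords} (h : 0 < q.2.2.1) : ContinuousAt angle q := by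
  have h1 : ContinuousAt Complex.arg ⟨q.2.2.1, q.2.2.2⟩ := Complex.continuousAt_arg (.inl h)
  have h2 : Continuous fun q : Coords => (⟨q.2.2.1, q.2.2.2⟩ : ℂ) := by
    have : (fun q : Coords => (⟨q.2.2.1, q.2.2.2⟩ : ℂ)) =
        fun q : Coords => Complex.equivRealProdCLM.symm (q.2.2.1, q.2.2.2) := by
      funext q
      apply Complex.ext <;> simp
    rw [this]
    fun_prop
  exact ContinuousAt.comp (f := fun q : Coords => (⟨q.2.2.1, q.2.2.2⟩ : ℂ)) h1 h2.continuousAt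

theorem continuousAt_overX {q : Coords} (h : 0 < q.2.2.1) : ContinuousAt overX q := by
  have := continuousAt_angle h
  unfold overX
  fun_prop

theorem continuousAt_underX {q : Coords} (h : 0 < q.2.2.1) : ContinuousAt underX q := by
  have := continuousAt_angle h
  unfold underX
  fun_prop

theorem re_pos_of_mem_mid {q : Coords} (h : q ∈ mid) : 0 < q.2.2.1 :=
  (abs_nonneg _).trans_lt h.1

theorem isOpen_mid : IsOpen mid := by
  rw [isOpen_iff_mem_nhds]
  intro q hq
  have ha := re_pos_of_mem_mid hq
  have hang := continuousAt_angle ha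
  obtain ⟨h1, h2, h3, h4, h5⟩ := hq
  have g1 : ∀ᶠ q' : Coords in 𝓝 q, |q'.2.2.2| < q'.2.2.1 :=
    ContinuousAt.eventually_lt (by fun_prop) (by fun_prop) h1
  have g2 : ∀ᶠ q' : Coords in 𝓝 q, -q'.rad < q'.1 :=
    ContinuousAt.eventually_lt (by fun_prop) (by fun_prop) h2
  have g3 : ∀ᶠ q' : Coords in 𝓝 q, q'.1 < 0 :=
    ContinuousAt.eventually_lt (by fun_prop) (by fun_prop) h3
  have g4 : ∀ᶠ q' : Coords in 𝓝 q, q'.1 = q'.overX →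
      q'.2.1 < q'.rad * Real.sin (4 * (2 * Real.pi / 3 + q'.angle / 3)) := by
    by_cases hx : q.1 = q.overX
    · exact (ContinuousAt.eventually_lt (by fun_prop) (by fun_prop) (h4 hx)).mono fun _ h _ => h
    · have h0 : ContinuousAt (fun q' : Coords => q'.1 - q'.overX) q :=
        continuousAt_fst.sub (continuousAt_overX ha)
      exact (h0.eventually_ne (sub_ne_zero.2 hx)).mono fun _ h h' => absurd (sub_eq_zero.2 h') h
  have g5 : ∀ᶠ q' : Coords in 𝓝 q, q'.1 = q'.underX →
      q'.rad * Real.sin (4 * (-(2 * Real.pi / 3) + q'.angle / 3)) < q'.2.1 := by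
    by_cases hx : q.1 = q.underX
    · exact (ContinuousAt.eventually_lt (by fun_prop) (by fun_prop) (h5 hx)).mono fun _ h _ => h
    · have h0 : ContinuousAt (fun q' : Coords => q'.1 - q'.underX) q :=
        continuousAt_fst.sub (continuousAt_underX ha)
      exact (h0.eventually_ne (sub_ne_zero.2 hx)).mono fun _ h h' => absurd (sub_eq_zero.2 h') h
  filter_upwards [g1, g2, g3, g4, g5] with q' a1 a2 a3 a4 a5
  exact ⟨a1, a2, a3, a4, a5⟩

/-- Tripling the parameter of the over-strand gives `angle + 2π`. Equality would thus put the point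
over that strand, where `mid` requires it to be below and `top` above. -/
theorem fst_ne_overX {q : Coords} (h : q ∈ mid) (h' : q ∈ top) : q.1 ≠ q.overX := by
  intro hx
  refine lt_asymm (h.2.2.2.1 hx) (h' _ ⟨hx, ?_, ?_⟩)
  · rw [show 3 * (2 * Real.pi / 3 + q.angle / 3) = q.angle + 2 * Real.pi by ring,
      Real.cos_add_two_pi]
    exact q.re_im_eq.1
  · rw [show 3 * (2 * Real.pi / 3 + q.angle / 3) = q.angle + 2 * Real.pi by ring,
      Real.sin_add_two_pi]
    exact q.re_im_eq.2

theorem fst_ne_underX {q : Coords} (h : q ∈ mid) (h' : q ∈ bot) : q.1 ≠ q.underX := by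
  intro hx
  refine lt_asymm (h.2.2.2.2 hx) (h' _ ⟨hx, ?_, ?_⟩)
  · rw [show 3 * (-(2 * Real.pi / 3) + q.angle / 3) = q.angle - 2 * Real.pi by ring,
      Real.cos_sub_two_pi]
    exact q.re_im_eq.1
  · rw [show 3 * (-(2 * Real.pi / 3) + q.angle / 3) = q.angle - 2 * Real.pi by ring,
      Real.sin_sub_two_pi]
    exact q.re_im_eq.2

theorem cos_four_pi_div_three : Real.cos (4 * Real.pi / 3) = -(1 / 2) := by
  rw [show 4 * Real.pi / 3 = Real.pi / 3 + Real.pi by ring, Real.cos_add_pi, Real.cos_pi_div_three]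

theorem sin_four_pi_div_three : Real.sin (4 * Real.pi / 3) = -(√3 / 2) := by
  rw [show 4 * Real.pi / 3 = Real.pi / 3 + Real.pi by ring, Real.sin_add_pi, Real.sin_pi_div_three]

theorem overX_eq (q : Coords) : q.overX =
    q.rad * (-(Real.cos (2 * q.angle / 3) / 2) + √3 / 2 * Real.sin (2 * q.angle / 3)) := by
  rw [overX, show 2 * (2 * Real.pi / 3 + q.angle / 3) = 4 * Real.pi / 3 + 2 * q.angle / 3 by ring,
    Real.cos_add, cos_four_pi_div_three, sin_four_pi_div_three]
  ring

theorem underX_eq (q : Coords) : q.underX =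
    q.rad * (-(Real.cos (2 * q.angle / 3) / 2) - √3 / 2 * Real.sin (2 * q.angle / 3)) := by
  rw [underX, show 2 * (-(2 * Real.pi / 3) + q.angle / 3) =
    -(4 * Real.pi / 3 - 2 * q.angle / 3) by ring, Real.cos_neg,
    Real.cos_sub, cos_four_pi_div_three, sin_four_pi_div_three]
  ring

/-- The roots of `4X³ - 3X = cos 2θ` are the numbers `cos (2(θ + 2πk) / 3)`: the over-strand for `k
= 1`, the under-strand for `k = -1`, and the third strand for `k = 0`. -/
theorem disc_eq (q : Coords) : q.disc =
    -4 * (q.1 - q.overX) * (q.1 - q.underX) * (q.1 - q.rad * Real.cos (2 * q.angle / 3)) := by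
  have h3 : √3 ^ 2 = (3 : ℝ) := Real.sq_sqrt (by norm_num)
  have e1 : Real.cos (2 * q.angle) = Real.cos (3 * (2 * q.angle / 3)) := by ring_nf
  rw [Real.cos_two_mul', Real.cos_three_mul (2 * q.angle / 3)] at e1
  have e2 := Real.sin_sq_add_cos_sq (2 * q.angle / 3)
  rw [overX_eq, underX_eq, disc]
  rw [q.re_im_eq.1, q.re_im_eq.2]
  set c := Real.cos (2 * q.angle / 3)
  set s := Real.sin (2 * q.angle / 3)
  set r := q.rad
  set x := q.1
  linear_combination r ^ 3 * e1 + (3 * r ^ 3 * c - 3 * r ^ 2 * x) * e2 -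
    (x - r * c) * r ^ 2 * s ^ 2 * h3

/-- Near the crossing with angle `0`, the label is the product of a factor which depends on the side
of the over-strand and one which depends on the side of the under-strand. -/
theorem label_eq_of_mem_mid {Γ : Type*} [Group Γ] (w e p m u v : Γ) (hp : p = v * w⁻¹ * u)
    {q : Coords} (h : q ∈ mid) (hd : q.disc ≠ 0) :
    open scoped Classical in
    label w e p m u v q =
      (if q.1 < q.overX then 1 else v * w⁻¹) * (if q.1 < q.underX then w else u) := by
  have ha := re_pos_of_mem_mid h
  have hr := rad_pos ha
  have hθ := abs_lt.1 (abs_angle_lt ha)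
  have hc : 0 < Real.cos (2 * q.angle / 3) :=
    Real.cos_pos_of_mem_Ioo ⟨by linarith [hθ.1], by linarith [hθ.2]⟩
  have hx : q.1 < 0 := h.2.2.1
  -- The third strand stays on the other side of `x = 0`, so in `mid` the sign of `disc` is that of
  -- the product of the factors of the two crossing strands.
  have hx3 : q.1 - q.rad * Real.cos (2 * q.angle / 3) < 0 := by nlinarith
  have hD := disc_eq q
  have h3 : √3 ^ 2 = (3 : ℝ) := Real.sq_sqrt (by norm_num)
  have h3p : 0 < √(3 : ℝ) := by positivity
  have e2 := Real.sin_sq_add_cos_sq (2 * q.angle / 3)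
  have n1 : q.1 - q.overX ≠ 0 := fun h0 => hd (by rw [hD, h0]; ring)
  have n2 : q.1 - q.underX ≠ 0 := fun h0 => hd (by rw [hD, h0]; ring)
  have ho := overX_eq q
  have hu := underX_eq q
  set c := Real.cos (2 * q.angle / 3)
  set s := Real.sin (2 * q.angle / 3) with hs
  have hpos : ∀ z : ℝ, 0 < z → 0 < -4 * z * (q.1 - q.rad * c) := fun z hz => by nlinarith
  have hneg : ∀ z : ℝ, z < 0 → -4 * z * (q.1 - q.rad * c) < 0 := fun z hz => by nlinarith
  have hD' : q.disc = -4 * ((q.1 - q.overX) * (q.1 - q.underX)) * (q.1 - q.rad * c) := by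
    rw [hD]; ring
  have hss : 0 < s → 0 < q.2.2.2 := by
    intro h0
    have : 0 < q.angle := by
      by_contra hh
      push Not at hh
      exact absurd (Real.sin_nonpos_of_nonpos_of_neg_pi_le (x := 2 * q.angle / 3) (by linarith)
        (by linarith [hθ.1])) (not_le.2 h0)
    rw [q.re_im_eq.2]
    exact mul_pos hr (Real.sin_pos_of_pos_of_lt_pi this (by linarith [hθ.2]))
  have hss' : s < 0 → q.2.2.2 < 0 := by
    intro h0
    have : q.angle < 0 := by
      by_contra hh
      push Not at hh
      exact absurd (Real.sin_nonneg_of_nonneg_of_le_pi (x := 2 * q.angle / 3) (by linarith)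
        (by linarith [hθ.2])) (not_le.2 h0)
    rw [q.re_im_eq.2]
    exact mul_neg_of_pos_of_neg hr (Real.sin_neg_of_neg_of_neg_pi_lt this (by linarith [hθ.1]))
  have hrx : ¬ q.rad < 2 * q.1 := by linarith
  rcases lt_or_gt_of_ne n1 with l1 | l1 <;> rcases lt_or_gt_of_ne n2 with l2 | l2
  · have hdp : 0 < q.disc := by rw [hD']; exact hpos _ (mul_pos_of_neg_of_neg l1 l2)
    -- Otherwise `c ± √3 * s < 1` for both signs, which contradicts `c > 0` and `c² + s² = 1`.
    have : 2 * q.1 < -q.rad := by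
      by_contra hh
      push Not at hh
      have a1 : q.rad * (c - √3 * s) < q.rad * 1 := by nlinarith
      have a2 : q.rad * (c + √3 * s) < q.rad * 1 := by nlinarith
      have a1 := lt_of_mul_lt_mul_left a1 hr.le
      have a2 := lt_of_mul_lt_mul_left a2 hr.le
      rcases le_total 0 s with hs0 | hs0
      · nlinarith [mul_nonneg h3p.le hs0, mul_nonneg (mul_nonneg h3p.le hs0) hc.le]
      · nlinarith [mul_nonneg h3p.le (neg_nonneg.2 hs0),
          mul_nonneg (mul_nonneg h3p.le (neg_nonneg.2 hs0)) hc.le]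
    rw [label, if_pos hdp, if_pos this, if_pos (by linarith), if_pos (by linarith), one_mul]
  · have hdn : ¬ 0 < q.disc := by
      rw [hD', not_lt]; exact (hneg _ (mul_neg_of_neg_of_pos l1 l2)).le
    have : 0 < q.2.2.2 := hss (by
      have : 0 < q.rad * (√3 * s) := by nlinarith
      exact pos_of_mul_pos_right (pos_of_mul_pos_right this hr.le) h3p.le)
    rw [label, if_neg hdn, if_neg hrx, if_pos this, if_pos (by linarith), if_neg (by linarith),
      one_mul]
  · have hdn : ¬ 0 < q.disc := by
      rw [hD', not_lt]; exact (hneg _ (mul_neg_of_pos_of_neg l1 l2)).le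
    have : q.2.2.2 < 0 := hss' (by
      have : 0 < q.rad * (√3 * -s) := by nlinarith
      linarith [pos_of_mul_pos_right (pos_of_mul_pos_right this hr.le) h3p.le])
    rw [label, if_neg hdn, if_neg hrx, if_neg (by linarith), if_neg (by linarith),
      if_pos (by linarith), inv_mul_cancel_right]
  · have hdp : 0 < q.disc := by rw [hD']; exact hpos _ (mul_pos l1 l2)
    -- Otherwise `c ± √3 * s > 1` for both signs; adding gives `c > 1`.
    have : ¬ 2 * q.1 < -q.rad := by
      intro hh
      have a1 : q.rad * 1 < q.rad * (c - √3 * s) := by nlinarith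
      have a2 : q.rad * 1 < q.rad * (c + √3 * s) := by nlinarith
      have a1 := lt_of_mul_lt_mul_left a1 hr.le
      have a2 := lt_of_mul_lt_mul_left a2 hr.le
      nlinarith
    rw [label, if_pos hdp, if_neg this, if_pos ha, if_neg (by linarith), if_neg (by linarith), hp]

/-- The gauge on `mid`, relative to the trivial gauge on `top`. -/
noncomputable def midGauge {Γ : Type*} [Group Γ] (w u v : Γ) (q : Coords) : Γ :=
  open scoped Classical in
  if q ∈ top then (if q.1 < q.overX then 1 else v * w⁻¹) else (if q.1 < q.underX then w else u)⁻¹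

/-- The gauge on `bot`, relative to the trivial gauge on `top`. -/
noncomputable def botGauge {Γ : Type*} [Group Γ] (w e p m u v : Γ) (q : Coords) : Γ :=
  open scoped Classical in
  if q ∈ top then label w e p m u v q else 1

theorem eventually_botGauge {Γ : Type*} [Group Γ] (w e p m u v : Γ) {q : Coords} (h : q ∈ top)
    (h' : q ∈ bot) :
    ∀ᶠ q' in 𝓝 q, botGauge w e p m u v q' = botGauge w e p m u v q := by
  filter_upwards [isOpen_top.mem_nhds h, eventually_label w e p m u v (disc_ne_zero h h')]
    with q' h1 h2
  rw [botGauge, botGauge, if_pos h, if_pos h1, h2]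

theorem eventually_lt_iff {f : Coords → ℝ} {q : Coords} (hf : ContinuousAt f q) (h : q.1 ≠ f q) :
    ∀ᶠ q' : Coords in 𝓝 q, (q'.1 < f q' ↔ q.1 < f q) := by
  rcases lt_or_gt_of_ne h with h1 | h1
  · filter_upwards [continuousAt_fst.eventually_lt hf h1] with q' h2
    exact iff_of_true h2 h1
  · filter_upwards [hf.eventually_lt continuousAt_fst h1] with q' h2
    exact iff_of_false (not_lt.2 h2.le) (not_lt.2 h1.le)

theorem eventually_midGauge {Γ : Type*} [Group Γ] (w u v : Γ) {q : Coords} (h : q ∈ mid)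
    (h' : q ∈ top) : ∀ᶠ q' in 𝓝 q, midGauge w u v q' = midGauge w u v q := by
  filter_upwards [isOpen_top.mem_nhds h', eventually_lt_iff
    (continuousAt_overX (re_pos_of_mem_mid h)) (fst_ne_overX h h')] with q' h1 h2
  rw [midGauge, midGauge, if_pos h', if_pos h1, if_congr h2 rfl rfl]

/-- Inside `top` the factor of the over-strand cancels by the Dehn relation. Outside `top`, where
`botGauge` takes its default value `1`, `midGauge` was defined to give the same answer. So the
transition ignores the over-strand, which a point of `mid ∩ bot` may pass beneath. -/
theorem midGauge_inv_mul_botGauge {Γ : Type*} [Group Γ] (w e p m u v : Γ) (hp : p = v * w⁻¹ * u)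
    {q : Coords} (h : q ∈ mid) (h' : q ∈ bot) :
    open scoped Classical in
    (midGauge w u v q)⁻¹ * botGauge w e p m u v q = if q.1 < q.underX then w else u := by
  by_cases ht : q ∈ top
  · rw [midGauge, botGauge, if_pos ht, if_pos ht,
      label_eq_of_mem_mid w e p m u v hp h (disc_ne_zero ht h'), inv_mul_cancel_left]
  · rw [midGauge, botGauge, if_neg ht, if_neg ht, inv_inv, mul_one]

theorem eventually_midGauge_inv_mul_botGauge {Γ : Type*} [Group Γ] (w e p m u v : Γ)
    (hp : p = v * w⁻¹ * u) {q : Coords} (h : q ∈ mid) (h' : q ∈ bot) :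
    ∀ᶠ q' in 𝓝 q, (midGauge w u v q')⁻¹ * botGauge w e p m u v q' =
      (midGauge w u v q)⁻¹ * botGauge w e p m u v q := by
  filter_upwards [isOpen_bot.mem_nhds h', isOpen_mid.mem_nhds h, eventually_lt_iff
    (continuousAt_underX (re_pos_of_mem_mid h)) (fst_ne_underX h h')] with q' h1 h2 h3
  rw [midGauge_inv_mul_botGauge w e p m u v hp h h', midGauge_inv_mul_botGauge w e p m u v hp h2 h1,
    if_congr h3 rfl rfl]

end Coords

end Diagram

/-! ### The cover by charts and the global gauge. -/

section Diagram

open Topology Set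

namespace Coords

theorem rad_smul {k : ℝ} (hk : 0 ≤ k) (q : Coords) : (k • q).rad = k * q.rad := by
  have : (k • q).2.2.1 ^ 2 + (k • q).2.2.2 ^ 2 = k ^ 2 * (q.2.2.1 ^ 2 + q.2.2.2 ^ 2) := by
    simp only [Prod.smul_snd, Prod.smul_fst, smul_eq_mul]
    ring
  rw [rad, rad, this, Real.sqrt_mul (sq_nonneg k), Real.sqrt_sq hk]

theorem over_smul_iff {k : ℝ} (hk : 0 < k) (q : Coords) (t : ℝ) : (k • q).Over t ↔ q.Over t := by
  simp only [Over, rad_smul hk.le, Prod.smul_snd, Prod.smul_fst, smul_eq_mul, mul_assoc,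
    mul_right_inj' hk.ne']

theorem smul_mem_top_iff {k : ℝ} (hk : 0 < k) (q : Coords) : k • q ∈ top ↔ q ∈ top := by
  simp only [top, mem_ofPred_eq, over_smul_iff hk, rad_smul hk.le, Prod.smul_snd, Prod.smul_fst,
    smul_eq_mul, mul_assoc, mul_lt_mul_iff_right₀ hk]

theorem smul_mem_bot_iff {k : ℝ} (hk : 0 < k) (q : Coords) : k • q ∈ bot ↔ q ∈ bot := by
  simp only [bot, mem_ofPred_eq, over_smul_iff hk, rad_smul hk.le, Prod.smul_snd, Prod.smul_fst,
    smul_eq_mul, mul_assoc, mul_lt_mul_iff_right₀ hk]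

theorem disc_smul {k : ℝ} (hk : 0 ≤ k) (q : Coords) : (k • q).disc = k ^ 3 * q.disc := by
  simp only [disc, rad_smul hk, Prod.smul_snd, Prod.smul_fst, smul_eq_mul]
  ring

theorem label_smul {Γ : Type*} (w e p m u v : Γ) {k : ℝ} (hk : 0 < k) (q : Coords) :
    label w e p m u v (k • q) = label w e p m u v q := by
  have h1 : 0 < k ^ 3 * q.disc ↔ 0 < q.disc := mul_pos_iff_of_pos_left (by positivity)
  have h2 : 2 * (k * q.1) < -(k * q.rad) ↔ 2 * q.1 < -q.rad := by
    rw [← mul_lt_mul_iff_right₀ hk (b := 2 * q.1)]; ring_nf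
  have h3 : k * q.rad < 2 * (k * q.1) ↔ q.rad < 2 * q.1 := by
    rw [← mul_lt_mul_iff_right₀ hk (b := q.rad)]; ring_nf
  simp only [label, disc_smul hk.le, rad_smul hk.le, Prod.smul_snd, Prod.smul_fst, smul_eq_mul,
    h1, h2, h3, mul_pos_iff_of_pos_left hk]

theorem top_subset_offKnot : top ⊆ offKnot := fun _ h t ht => (h t ht).ne'

theorem bot_subset_offKnot : bot ⊆ offKnot := fun _ h t ht => (h t ht).ne

theorem continuous_rot_iterate (j : ℕ) : Continuous (rot^[j]) := continuous_rot.iterate j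

theorem rot_iterate_mem_top_iff {q : Coords} (j : ℕ) : rot^[j] q ∈ top ↔ q ∈ top := by
  induction j generalizing q with
  | zero => rfl
  | succ j ih =>
    rw [Function.iterate_succ_apply, ih]
    refine ⟨fun h => ?_, rot_mem_top⟩
    rw [← rot_rot_rot_rot q]
    exact rot_mem_top (rot_mem_top (rot_mem_top h))

theorem rot_iterate_mem_bot {q : Coords} (h : q ∈ bot) (j : ℕ) : rot^[j] q ∈ bot := by
  induction j generalizing q with
  | zero => exact h
  | succ j ih => rw [Function.iterate_succ_apply]; exact ih (rot_mem_bot h)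

theorem rad_rot_iterate (q : Coords) (j : ℕ) : (rot^[j] q).rad = q.rad := by
  induction j with
  | zero => rfl
  | succ j ih => rw [Function.iterate_succ_apply', rad_rot, ih]

theorem rot_iterate_snd_fst (q : Coords) (j : ℕ) : (rot^[j] q).2.1 = q.2.1 := by
  induction j with
  | zero => rfl
  | succ j ih => rw [Function.iterate_succ_apply', ← ih]; rfl

theorem Over.rot_iterate {q : Coords} {t : ℝ} (h : q.Over t) (j : ℕ) :
    (Coords.rot^[j] q).Over (t + j * (Real.pi / 2)) := by
  induction j with
  | zero => simpa using h
  | succ j ih =>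
    rw [Function.iterate_succ_apply']
    convert ih.rot using 1
    push_cast; ring

/-- A point off the knot which is neither above nor below it lies between the two strands of a
crossing. -/
theorem exists_crossing {q : Coords} (h : q ∈ offKnot) (h1 : q ∉ top) (h2 : q ∉ bot) :
    ∃ j < 4, (rot^[j] q).Over (2 * Real.pi / 3) ∧ 0 < q.rad ∧
      q.2.1 < q.rad * Real.sin (4 * (2 * Real.pi / 3)) ∧
      q.rad * Real.sin (4 * (-(2 * Real.pi / 3))) < q.2.1 := by
  simp only [top, bot, mem_ofPred_eq, not_forall, not_lt] at h1 h2
  obtain ⟨t, ht, hy⟩ := h1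
  obtain ⟨t', ht', hy'⟩ := h2
  have hy := lt_of_le_of_ne hy (h t ht)
  have hy' := lt_of_le_of_ne hy' (h t' ht').symm
  have hr : 0 < q.rad := by
    refine lt_of_le_of_ne (rad_nonneg q) fun h0 => ?_
    rw [← h0] at hy hy'
    linarith
  have hsin : Real.sin (4 * t') < Real.sin (4 * t) :=
    lt_of_mul_lt_mul_left (hy'.trans hy) hr.le
  have c2 : Real.cos (2 * t) = Real.cos (2 * t') :=
    mul_left_cancel₀ hr.ne' (ht.1.symm.trans ht'.1)
  have c3 : Real.cos (3 * t) = Real.cos (3 * t') :=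
    mul_left_cancel₀ hr.ne' (ht.2.1.symm.trans ht'.2.1)
  have s3 : Real.sin (3 * t) = Real.sin (3 * t') :=
    mul_left_cancel₀ hr.ne' (ht.2.2.symm.trans ht'.2.2)
  obtain ⟨k, hk | hk⟩ := Real.cos_eq_cos_iff.1 c2
  · refine absurd hsin.ne (not_not.2 ?_)
    rw [show 4 * t' = 4 * t + (2 * k : ℤ) * (2 * Real.pi) by push_cast; linarith,
      Real.sin_add_int_mul_two_pi]
  · have hd : Real.cos (3 * t - 3 * t') = 1 := by
      rw [Real.cos_sub, ← c3, ← s3]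
      nlinarith [Real.sin_sq_add_cos_sq (3 * t)]
    obtain ⟨l, hl⟩ := (Real.cos_eq_one_iff _).1 hd
    have ht0 : t = k * (Real.pi / 2) + l * (Real.pi / 3) := by linarith
    have hneg : Real.sin (4 * t') = -Real.sin (4 * t) := by
      rw [show 4 * t' = -(4 * t - (2 * k : ℤ) * (2 * Real.pi)) by push_cast; linarith,
        Real.sin_neg, Real.sin_sub_int_mul_two_pi]
    have hpos : 0 < Real.sin (4 * t) := by linarith
    -- The double points of the projection are `t = kπ/2 + lπ/3`. The residue 0 is no crossing, and
    -- 1 and 2 are the under- and over-strand; `sin 4t > 0` selects 2.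
    have hl3 : l % 3 = 2 := by
      have hcase : l % 3 = 0 ∨ l % 3 = 1 ∨ l % 3 = 2 := by lia
      have hdm : (l : ℝ) = 3 * (l / 3 : ℤ) + (l % 3 : ℤ) := by
        exact_mod_cast (Int.mul_ediv_add_emod l 3).symm
      rcases hcase with h0 | h0 | h0
      · rw [h0] at hdm
        rw [ht0, hdm, show 4 * (k * (Real.pi / 2) + (3 * ((l / 3 : ℤ) : ℝ) + (0 : ℤ)) *
          (Real.pi / 3)) = 0 + (k + 2 * (l / 3) : ℤ) * (2 * Real.pi) by push_cast; ring,
          Real.sin_add_int_mul_two_pi, Real.sin_zero] at hpos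
        exact absurd hpos (lt_irrefl _)
      · rw [h0] at hdm
        rw [ht0, hdm, show 4 * (k * (Real.pi / 2) + (3 * ((l / 3 : ℤ) : ℝ) + (1 : ℤ)) *
          (Real.pi / 3)) = 4 * Real.pi / 3 + (k + 2 * (l / 3) : ℤ) * (2 * Real.pi) by
            push_cast; ring,
          Real.sin_add_int_mul_two_pi, sin_four_pi_div_three] at hpos
        have : 0 < √(3 : ℝ) := by positivity
        linarith
      · exact h0
    have hdm : (l : ℝ) = 3 * (l / 3 : ℤ) + 2 := by
      have := (Int.mul_ediv_add_emod l 3).symm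
      rw [hl3] at this
      exact_mod_cast this
    have htn : t = 2 * Real.pi / 3 + (k + 2 * (l / 3) : ℤ) * (Real.pi / 2) := by
      rw [ht0, hdm]; push_cast; ring
    set n : ℤ := k + 2 * (l / 3)
    have hsn : Real.sin (4 * t) = Real.sin (4 * (2 * Real.pi / 3)) := by
      rw [htn, show 4 * (2 * Real.pi / 3 + n * (Real.pi / 2)) =
        4 * (2 * Real.pi / 3) + n * (2 * Real.pi) by ring, Real.sin_add_int_mul_two_pi]
    -- One rotation adds `π / 2` to the parameter, so `-n` rotations, reduced modulo 4, bring the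
    -- crossing to angle 0.
    refine ⟨((-n) % 4).toNat, by lia, ?_, hr, by rwa [← hsn], ?_⟩
    · have hj : ((((-n) % 4).toNat : ℕ) : ℝ) = -n - 4 * ((-n) / 4 : ℤ) := by
        have : ((((-n) % 4).toNat : ℕ) : ℤ) = -n - 4 * ((-n) / 4) := by lia
        exact_mod_cast this
      convert (ht.rot_iterate ((-n) % 4).toNat).congr (((-n) / 4)) using 1
      rw [hj, htn]; ring
    · rw [mul_neg, Real.sin_neg, ← hsn, ← hneg]
      exact hy'

theorem mem_mid_of_over {q : Coords} (h : q.Over (2 * Real.pi / 3)) (hr : 0 < q.rad)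
    (h1 : q.2.1 < q.rad * Real.sin (4 * (2 * Real.pi / 3)))
    (h2 : q.rad * Real.sin (4 * (-(2 * Real.pi / 3))) < q.2.1) : q ∈ mid := by
  obtain ⟨e1, e2, e3⟩ := h
  rw [show 3 * (2 * Real.pi / 3) = 2 * Real.pi by ring] at e2 e3
  rw [show 2 * (2 * Real.pi / 3) = 4 * Real.pi / 3 by ring, cos_four_pi_div_three] at e1
  rw [Real.cos_two_pi] at e2
  rw [Real.sin_two_pi] at e3
  have hang : q.angle = 0 := by
    rw [angle, e3, mul_zero]
    exact Complex.arg_ofReal_of_nonneg (by rw [e2]; linarith)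
  refine ⟨?_, by linarith, by linarith, fun _ => ?_, fun _ => ?_⟩
  · rw [e3, e2]; simpa using hr
  · simpa [hang] using h1
  · simpa [hang] using h2

/-- The boxes around the four crossings are disjoint. -/
theorem eq_of_mem_mid {q : Coords} {i j : ℕ} (hi : i < 4) (hj : j < 4) (h : rot^[i] q ∈ mid)
    (h' : rot^[j] q ∈ mid) : i = j := by
  have a1 := h.1
  have a3 := h.2.2.1
  have b1 := h'.1
  have b3 := h'.2.2.1
  rw [abs_lt] at a1 b1
  interval_cases i <;> interval_cases j <;> first
    | rfl
    | (exfalso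
       simp only [Function.iterate_succ_apply, Function.iterate_zero, id, rot] at a1 a3 b1 b3
       linarith)

end Coords

/-- Labels of the six regions of the diagram of the figure-eight knot. -/
structure RegionLabels (Γ : Type*) where
  w : Γ
  e : Γ
  p : Γ
  m : Γ
  u : Γ
  v : Γ

namespace RegionLabels

open Coords

/-- The charts: above the knot, below it, and near the four crossings. -/
def chart : Bool ⊕ Fin 4 → Set Coords
  | .inl true => Coords.top
  | .inl false => Coords.bot
  | .inr j => rot^[j] ⁻¹' Coords.mid

theorem isOpen_chart (i : Bool ⊕ Fin 4) : IsOpen (chart i) :=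
  match i with
  | .inl true => isOpen_top
  | .inl false => isOpen_bot
  | .inr j => isOpen_mid.preimage (continuous_rot_iterate j)

theorem exists_mem_chart {q : Coords} (h : q ∈ offKnot) : ∃ i, q ∈ chart i := by
  by_cases h1 : q ∈ Coords.top
  · exact ⟨.inl true, h1⟩
  by_cases h2 : q ∈ Coords.bot
  · exact ⟨.inl false, h2⟩
  obtain ⟨j, hj, ho, hr, hy, hy'⟩ := exists_crossing h h1 h2
  refine ⟨.inr ⟨j, hj⟩, ?_⟩
  rw [← rad_rot_iterate q j, ← rot_iterate_snd_fst q j] at hy hy'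
  exact mem_mid_of_over ho (by rwa [rad_rot_iterate]) hy hy'

variable {Γ : Type*}

/-- The labels of the rotated diagram. -/
def shift (L : RegionLabels Γ) : RegionLabels Γ := ⟨L.e, L.w, L.u, L.v, L.m, L.p⟩

/-- The Dehn relations at the four crossings. -/
structure IsCoherent [Group Γ] (L : RegionLabels Γ) : Prop where
  p_eq : L.p = L.v * L.w⁻¹ * L.u
  u_eq : L.u = L.p * L.e⁻¹ * L.m
  m_eq : L.m = L.u * L.w⁻¹ * L.v
  v_eq : L.v = L.m * L.e⁻¹ * L.p

variable [Group Γ]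

theorem IsCoherent.shift {L : RegionLabels Γ} (h : L.IsCoherent) : L.shift.IsCoherent :=
  ⟨h.u_eq, h.m_eq, h.v_eq, h.p_eq⟩

theorem IsCoherent.shift_iterate {L : RegionLabels Γ} (h : L.IsCoherent) (j : ℕ) :
    (RegionLabels.shift^[j] L).IsCoherent := by
  induction j with
  | zero => exact h
  | succ j ih => rw [Function.iterate_succ_apply']; exact ih.shift

/-- The gauge on `bot`. -/
noncomputable def bot (L : RegionLabels Γ) : Coords → Γ := botGauge L.w L.e L.p L.m L.u L.v

/-- The gauge on `mid`. -/
noncomputable def mid (L : RegionLabels Γ) : Coords → Γ := midGauge L.w L.u L.v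

/-- The rotation swaps the two checkerboard colours and `shift` renames the labels to match, so
every crossing reduces to the one at angle 0. -/
theorem bot_rot_iterate (L : RegionLabels Γ) {q : Coords} (h : q ∈ Coords.bot) (j : ℕ) :
    (shift^[j] L).bot (rot^[j] q) = L.bot q := by
  induction j with
  | zero => rfl
  | succ j ih =>
    rw [Function.iterate_succ_apply', Function.iterate_succ_apply', ← ih]
    have hb := rot_iterate_mem_bot h j
    set q' := rot^[j] q
    set L' := RegionLabels.shift^[j] L
    by_cases ht : q' ∈ Coords.top
    · rw [bot, bot, botGauge, botGauge, if_pos ht, if_pos (rot_mem_top ht),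
        label_rot _ _ _ _ _ _ (disc_ne_zero ht hb)]
      rfl
    · rw [bot, bot, botGauge, botGauge, if_neg ht,
        if_neg (show q'.rot ∉ Coords.top from fun h => ht ((rot_iterate_mem_top_iff 1).1 h))]

/-- The gauge on the charts. -/
noncomputable def gauge (L : RegionLabels Γ) : Bool ⊕ Fin 4 → Coords → Γ
  | .inl true => fun _ => 1
  | .inl false => L.bot
  | .inr j => fun q => (shift^[j] L).mid (rot^[j] q)

/-- The transition between `top` and `bot` depends only on the region, and that between a box and
`top` or `bot` only on the side of the over- or under-strand. Different boxes are disjoint.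
Coherence enters only between `bot` and a box. -/
theorem eventually_gauge (L : RegionLabels Γ) (hL : L.IsCoherent) (i j : Bool ⊕ Fin 4)
    {q : Coords} (hq : q ∈ chart i ∩ chart j) :
    ∀ᶠ q' in 𝓝 q, (L.gauge j q')⁻¹ * L.gauge i q' = (L.gauge j q)⁻¹ * L.gauge i q := by
  have key : ∀ i j, q ∈ chart i ∩ chart j →
      (∀ᶠ q' in 𝓝 q, (L.gauge j q')⁻¹ * L.gauge i q' = (L.gauge j q)⁻¹ * L.gauge i q) →
      ∀ᶠ q' in 𝓝 q, (L.gauge i q')⁻¹ * L.gauge j q' = (L.gauge i q)⁻¹ * L.gauge j q := by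
    intro i j _ h
    filter_upwards [h] with q' h
    rw [← inv_inj]
    simpa using h
  have tb : q ∈ chart (.inl true) ∩ chart (.inl false) → ∀ᶠ q' in 𝓝 q,
      (L.gauge (.inl false) q')⁻¹ * L.gauge (.inl true) q' =
        (L.gauge (.inl false) q)⁻¹ * L.gauge (.inl true) q := by
    intro h
    filter_upwards [eventually_botGauge L.w L.e L.p L.m L.u L.v h.1 h.2] with q' h'
    simp only [gauge, bot, h']
  have tm : ∀ k, q ∈ chart (.inl true) ∩ chart (.inr k) → ∀ᶠ q' in 𝓝 q,
      (L.gauge (.inr k) q')⁻¹ * L.gauge (.inl true) q' =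
        (L.gauge (.inr k) q)⁻¹ * L.gauge (.inl true) q := by
    intro k h
    filter_upwards [(continuous_rot_iterate k).continuousAt.eventually
      (eventually_midGauge (shift^[k] L).w (shift^[k] L).u (shift^[k] L).v h.2
        ((rot_iterate_mem_top_iff k).2 h.1))] with q' h'
    simp only [gauge, mid, h']
  have bm : ∀ k, q ∈ chart (.inl false) ∩ chart (.inr k) → ∀ᶠ q' in 𝓝 q,
      (L.gauge (.inr k) q')⁻¹ * L.gauge (.inl false) q' =
        (L.gauge (.inr k) q)⁻¹ * L.gauge (.inl false) q := by
    intro k h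
    have hb : q ∈ Coords.bot := h.1
    filter_upwards [isOpen_bot.mem_nhds hb, (continuous_rot_iterate k).continuousAt.eventually
      (eventually_midGauge_inv_mul_botGauge (shift^[k] L).w (shift^[k] L).e (shift^[k] L).p
        (shift^[k] L).m (shift^[k] L).u (shift^[k] L).v (hL.shift_iterate k).p_eq h.2
        (rot_iterate_mem_bot hb k))] with q' hb' h'
    simp only [gauge]
    rw [← bot_rot_iterate L hb k, ← bot_rot_iterate L hb' k]
    exact h'
  match i, j, hq with
  | .inl true, .inl true, _ => simp
  | .inl false, .inl false, _ => simp
  | .inl true, .inl false, h => exact tb h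
  | .inl false, .inl true, h => exact key _ _ h.symm (tb h.symm)
  | .inl true, .inr k, h => exact tm k h
  | .inr k, .inl true, h => exact key _ _ h.symm (tm k h.symm)
  | .inl false, .inr k, h => exact bm k h
  | .inr k, .inl false, h => exact key _ _ h.symm (bm k h.symm)
  | .inr k, .inr l, h =>
    obtain rfl : k = l := Fin.ext (eq_of_mem_mid k.2 l.2 h.1 h.2)
    simp

end RegionLabels

end Diagram

/-! ### From the complement of the knot to homomorphisms of its group. -/

section Complement

open Topology Set Coords

/-- Coordinates on a space which is homeomorphic to the complement of the knot: an embedding in the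
cone over the complement, with a retraction that rescales the points. -/
structure KnotCoordinates (Y : Type*) [TopologicalSpace Y] where
  coord : C(Y, Coords)
  coord_mem : ∀ y, coord y ∈ offKnot
  proj : C(offKnot, Y)
  coord_proj : ∀ q : offKnot, ∃ k : ℝ, 0 < k ∧ coord (proj q) = k • q.1
  proj_coord : ∀ y, proj ⟨coord y, coord_mem y⟩ = y

namespace KnotCoordinates

variable {Y : Type*} [TopologicalSpace Y] (K : KnotCoordinates Y)

theorem mk_top_mem {z : ℝ} (hz : 0 < z) : ((0, z, 0, 0) : Coords) ∈ Coords.top := by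
  intro t _
  simpa [rad] using hz

theorem mk_bot_mem {z : ℝ} (hz : z < 0) : ((0, z, 0, 0) : Coords) ∈ Coords.bot := by
  intro t _
  simpa [rad] using hz

theorem mk_bot_notMem_top {z : ℝ} (hz : z < 0) : ((0, z, 0, 0) : Coords) ∉ Coords.top := by
  intro h
  have := h 0 (by simp [Over, rad])
  simp only [rad] at this
  simp at this
  linarith

/-- `top` is stable under raising the second coordinate and under positive scaling; a point of the
segment before its end arises by both operations. -/
theorem segment_top {q : Coords} (h : q ∈ Coords.top) {s : ℝ} (h0 : 0 ≤ s) (h1 : s ≤ 1) :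
    ((1 - s) • q + s • ((0, 1, 0, 0) : Coords)) ∈ Coords.top := by
  rcases h1.eq_or_lt with rfl | h1
  · simpa using mk_top_mem one_pos
  have e : (1 - s) • q + s • ((0, 1, 0, 0) : Coords) =
      (1 - s) • (q + (0, s / (1 - s), 0, 0)) := by
    have : 1 - s ≠ 0 := by linarith
    ext <;> simp
    field_simp
  rw [e, smul_mem_top_iff (by linarith)]
  intro t ht
  have e2 : (q + (0, s / (1 - s), 0, 0)).rad = q.rad := by simp [rad]
  have ht' : q.Over t := by
    obtain ⟨a, b, c⟩ := ht
    rw [e2] at a b c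
    exact ⟨by simpa using a, by simpa using b, by simpa using c⟩
  have := h t ht'
  rw [e2]
  have h3 : 0 ≤ s / (1 - s) := div_nonneg h0 (by linarith)
  simp only [Prod.snd_add, Prod.fst_add]
  linarith

theorem segment_bot {q : Coords} (h : q ∈ Coords.bot) {s : ℝ} (h0 : 0 ≤ s) (h1 : s ≤ 1) :
    ((1 - s) • q + s • ((0, -1, 0, 0) : Coords)) ∈ Coords.bot := by
  rcases h1.eq_or_lt with rfl | h1
  · simpa using mk_bot_mem (z := -1) (by norm_num)
  have e : (1 - s) • q + s • ((0, -1, 0, 0) : Coords) =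
      (1 - s) • (q + (0, -(s / (1 - s)), 0, 0)) := by
    have : 1 - s ≠ 0 := by linarith
    ext <;> simp
    field_simp
  rw [e, smul_mem_bot_iff (by linarith)]
  intro t ht
  have e2 : (q + (0, -(s / (1 - s)), 0, 0)).rad = q.rad := by simp [rad]
  have ht' : q.Over t := by
    obtain ⟨a, b, c⟩ := ht
    rw [e2] at a b c
    exact ⟨by simpa using a, by simpa using b, by simpa using c⟩
  have := h t ht'
  rw [e2]
  have h3 : 0 ≤ s / (1 - s) := div_nonneg h0 (by linarith)
  simp only [Prod.snd_add, Prod.fst_add]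
  linarith

/-- The point above the knot. -/
def topPt : Y := K.proj ⟨(0, 1, 0, 0), top_subset_offKnot (mk_top_mem one_pos)⟩

/-- The point below the knot. -/
def botPt : Y := K.proj ⟨(0, -1, 0, 0), bot_subset_offKnot (mk_bot_mem (by norm_num))⟩

/-- This makes the gauge on `bot` equal to its default value `1` at the lower base point. -/
theorem coord_botPt_notMem : K.coord K.botPt ∉ Coords.top := by
  obtain ⟨k, hk, h⟩ := K.coord_proj ⟨(0, -1, 0, 0), bot_subset_offKnot (mk_bot_mem (by norm_num))⟩
  rw [botPt, h, smul_mem_top_iff hk]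
  exact mk_bot_notMem_top (by norm_num)

/-- Paths in the cone over the complement project to the complement. -/
theorem exists_path (f : unitInterval → Coords) (hf : Continuous f) (hm : ∀ t, f t ∈ offKnot) :
    ∃ γ : Path (K.proj ⟨f 0, hm 0⟩) (K.proj ⟨f 1, hm 1⟩),
      ∀ t, ∃ k : ℝ, 0 < k ∧ K.coord (γ t) = k • f t :=
  ⟨{ toFun := fun t => K.proj ⟨f t, hm t⟩
     continuous_toFun := by fun_prop
     source' := rfl
     target' := rfl }, fun t => K.coord_proj ⟨f t, hm t⟩⟩

theorem exists_path_top {y : Y} (hy : K.coord y ∈ Coords.top) :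
    ∃ γ : Path y K.topPt, ∀ t, K.coord (γ t) ∈ Coords.top := by
  have hm : ∀ t : unitInterval,
      ((1 - (t : ℝ)) • K.coord y + (t : ℝ) • ((0, 1, 0, 0) : Coords)) ∈ Coords.top :=
    fun t => segment_top hy t.2.1 t.2.2
  obtain ⟨γ, hγ⟩ := K.exists_path _ (by fun_prop) (fun t => top_subset_offKnot (hm t))
  have h0 : y = K.proj _ := (K.proj_coord y).symm
  refine ⟨γ.cast (h0.trans ?_) ?_, fun t => ?_⟩
  · congr 2; simp
  · rw [topPt]; congr 2; simp
  · obtain ⟨k, hk, h⟩ := hγ t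
    rw [Path.cast_coe, h, smul_mem_top_iff hk]
    exact hm t

theorem exists_path_bot {y : Y} (hy : K.coord y ∈ Coords.bot) :
    ∃ γ : Path y K.botPt, ∀ t, K.coord (γ t) ∈ Coords.bot := by
  have hm : ∀ t : unitInterval,
      ((1 - (t : ℝ)) • K.coord y + (t : ℝ) • ((0, -1, 0, 0) : Coords)) ∈ Coords.bot :=
    fun t => segment_bot hy t.2.1 t.2.2
  obtain ⟨γ, hγ⟩ := K.exists_path _ (by fun_prop) (fun t => bot_subset_offKnot (hm t))
  have h0 : y = K.proj _ := (K.proj_coord y).symm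
  refine ⟨γ.cast (h0.trans ?_) ?_, fun t => ?_⟩
  · congr 2; simp
  · rw [botPt]; congr 2; simp
  · obtain ⟨k, hk, h⟩ := hγ t
    rw [Path.cast_coe, h, smul_mem_bot_iff hk]
    exact hm t

theorem joined_of_disc_ne_zero {y : Y} (h : (K.coord y).disc ≠ 0) : Joined K.topPt K.botPt := by
  obtain ⟨γ, -⟩ := K.exists_path_top (mem_top_of_disc_ne_zero h)
  obtain ⟨γ', -⟩ := K.exists_path_bot (mem_bot_of_disc_ne_zero h)
  exact ⟨γ.symm.trans γ'⟩

theorem disc_rot_iterate_ne_zero {q : Coords} (j : ℕ) :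
    (rot^[j] q).disc ≠ 0 ↔ q.disc ≠ 0 := by
  induction j with
  | zero => rfl
  | succ j ih => rw [Function.iterate_succ_apply', disc_rot, neg_ne_zero, ih]

/-- Stretching `x` at a crossing gives `disc = ± rad³ * s² * (3 + s) / 2`, so a point caught between
two strands escapes at once into a region. This is how such points are joined to `topPt`. -/
theorem disc_stretch_ne_zero {q : Coords} {j : ℕ}
    (ho : (rot^[j] q).Over (2 * Real.pi / 3)) (hr : 0 < q.rad) {s : ℝ} (hs : 0 < s) :
    Coords.disc ((1 + s) * q.1, q.2) ≠ 0 := by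
  obtain ⟨e1, e2, e3⟩ := ho
  rw [show 3 * (2 * Real.pi / 3) = 2 * Real.pi by ring] at e2 e3
  rw [show 2 * (2 * Real.pi / 3) = 4 * Real.pi / 3 by ring, cos_four_pi_div_three] at e1
  rw [Real.cos_two_pi] at e2
  rw [Real.sin_two_pi] at e3
  have hrot : rot^[j] ((1 + s) * q.1, q.2) = ((1 + s) * (rot^[j] q).1, (rot^[j] q).2) := by
    clear e1 e2 e3
    induction j with
    | zero => rfl
    | succ j ih =>
      rw [Function.iterate_succ_apply', Function.iterate_succ_apply', ih]
      ext <;> simp [rot]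
  rw [← disc_rot_iterate_ne_zero j, hrot]
  rw [rad_rot_iterate] at e1 e2 e3
  have e4 : Coords.rad ((1 + s) * (rot^[j] q).1, (rot^[j] q).2) = q.rad := by
    rw [← rad_rot_iterate q j]; rfl
  have : Coords.disc ((1 + s) * (rot^[j] q).1, (rot^[j] q).2) =
      q.rad ^ 3 * ((3 + s) / 2 * s ^ 2) := by
    rw [disc, e4]
    simp only [e1, e2, e3]
    ring
  rw [this]
  positivity

theorem joined_top (y : Y) : Joined y K.topPt := by
  have hmk : ∀ (q : Coords) (h : q.disc ≠ 0),
      (K.coord (K.proj ⟨q, top_subset_offKnot (mem_top_of_disc_ne_zero h)⟩)).disc ≠ 0 := by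
    intro q h
    obtain ⟨k, hk, e⟩ := K.coord_proj ⟨q, top_subset_offKnot (mem_top_of_disc_ne_zero h)⟩
    rw [e, disc_smul hk.le]
    exact mul_ne_zero (by positivity) h
  by_cases h1 : K.coord y ∈ Coords.top
  · exact ⟨(K.exists_path_top h1).choose⟩
  by_cases h2 : K.coord y ∈ Coords.bot
  · have := hmk (-1, 0, 0, 0) (by simp [disc, rad])
    exact Joined.trans ⟨(K.exists_path_bot h2).choose⟩ (K.joined_of_disc_ne_zero this).symm
  obtain ⟨j, -, ho, hr, -, -⟩ := exists_crossing (K.coord_mem y) h1 h2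
  have hd : ∀ s : ℝ, 0 < s → _ := fun s hs => disc_stretch_ne_zero ho hr hs
  have hm : ∀ t : unitInterval, ((1 + (t : ℝ)) * (K.coord y).1, (K.coord y).2) ∈ offKnot := by
    intro t
    rcases t.2.1.eq_or_lt with h0 | h0
    · rw [← h0]
      simpa using K.coord_mem y
    · exact top_subset_offKnot (mem_top_of_disc_ne_zero (hd _ h0))
  obtain ⟨γ, -⟩ := K.exists_path (fun t : unitInterval =>
    ((1 + (t : ℝ)) * (K.coord y).1, (K.coord y).2)) (by fun_prop) hm
  have h0 : y = K.proj _ := (K.proj_coord y).symm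
  have γ' := γ.cast (h0.trans (by congr 2; simp)) rfl
  refine Joined.trans ⟨γ'⟩ ⟨(K.exists_path_top ?_).choose⟩
  exact mem_top_of_disc_ne_zero (hmk _ (hd 1 one_pos))

/-- The fundamental group maps to every group with two elements that satisfy the relation of the
figure-eight knot, and the image contains these elements. -/
theorem exists_hom (K : KnotCoordinates Y) {Γ : Type*} [Group Γ] (U V : Γ)
    (hUV : V * U * V⁻¹ * U * V = U * V * U⁻¹ * V * U) (x : Y) :
    ∃ φ : FundamentalGroup Y x →* Γ, U ∈ φ.range ∧ V ∈ φ.range := by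
  -- With western label `1`, two Dehn relations define `p` and `m`, and the relation for `v` gives
  -- `e = p * v⁻¹ * m`. The one for `u` requires `e = m * u⁻¹ * p`, which is the knot relation.
  let L : RegionLabels Γ := ⟨1, V * U * V⁻¹ * U * V, V * U, U * V, U, V⟩
  have hL : L.IsCoherent := by
    refine ⟨?_, ?_, ?_, ?_⟩
    · simp [L]
    · simp only [L]; rw [hUV]; group
    · simp [L]
    · simp only [L]; group
  obtain ⟨m, m_refl, m_trans, m_chart⟩ := exists_holonomy
    (fun i => K.coord ⁻¹' RegionLabels.chart i)
    (fun i => (RegionLabels.isOpen_chart i).preimage K.coord.continuous)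
    (fun y => RegionLabels.exists_mem_chart (K.coord_mem y))
    (fun i y => L.gauge i (K.coord y))
    (fun i j y hy => K.coord.continuous.continuousAt.eventually (L.eventually_gauge hL i j hy))
  have m_symm : ∀ {y z : Y} (γ : Path.Homotopic.Quotient y z), m z y γ.symm = (m y z γ)⁻¹ := by
    intro y z γ
    rw [eq_inv_iff_mul_eq_one, ← m_trans, Path.Homotopic.Quotient.trans_symm, m_refl]
  have half : ∀ q : Coords, q.disc ≠ 0 → ∃ γ : Path.Homotopic.Quotient K.topPt K.botPt,
      m _ _ γ = (label L.w L.e L.p L.m L.u L.v q)⁻¹ := by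
    intro q hq
    have ht := mem_top_of_disc_ne_zero hq
    have hb := mem_bot_of_disc_ne_zero hq
    obtain ⟨k, hk, e⟩ := K.coord_proj ⟨q, top_subset_offKnot ht⟩
    set y := K.proj ⟨q, top_subset_offKnot ht⟩
    have ht' : K.coord y ∈ Coords.top := by rwa [e, smul_mem_top_iff hk]
    have hb' : K.coord y ∈ Coords.bot := by rwa [e, smul_mem_bot_iff hk]
    obtain ⟨γ, hγ⟩ := K.exists_path_top ht'
    obtain ⟨γ', hγ'⟩ := K.exists_path_bot hb'
    refine ⟨(Path.Homotopic.Quotient.mk γ).symm.trans (.mk γ'), ?_⟩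
    rw [m_trans, m_symm, m_chart _ _ γ (.inl true) hγ, m_chart _ _ γ' (.inl false) hγ']
    simp only [RegionLabels.gauge, RegionLabels.bot, botGauge, if_neg K.coord_botPt_notMem,
      if_pos ht']
    rw [e, label_smul _ _ _ _ _ _ hk]
    simp
  obtain ⟨δ⟩ := K.joined_top x
  have loop : ∀ q : Coords, q.disc ≠ 0 → ∃ γ : Path.Homotopic.Quotient K.topPt K.topPt,
      m _ _ γ = label L.w L.e L.p L.m L.u L.v q := by
    intro q hq
    obtain ⟨γ, hγ⟩ := half q hq
    obtain ⟨γ', hγ'⟩ := half (-1, 0, 0, 0) (by simp [disc, rad])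
    -- Descend through the western region, whose label is `1`, and return through the region of `q`.
    refine ⟨γ'.trans γ.symm, ?_⟩
    have hw : label L.w L.e L.p L.m L.u L.v (-1, 0, 0, 0) = 1 := by norm_num [label, disc, rad, L]
    rw [m_trans, m_symm, hγ, hγ', hw, inv_inv, inv_one, mul_one]
  -- Conjugating by the transport along `δ` makes the image contain the labels themselves rather
  -- than conjugates of them.
  let φ : FundamentalGroup Y x →* Γ :=
    { toFun := fun γ => m _ _ (.mk δ) * m _ _ γ.toPath * (m _ _ (.mk δ))⁻¹
      map_one' := by
        change m _ _ (.mk δ) * m _ _ (.refl x) * (m _ _ (.mk δ))⁻¹ = 1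
        rw [m_refl]; simp
      map_mul' := fun γ γ' => by
        change m _ _ (.mk δ) * m _ _ (Path.Homotopic.Quotient.trans γ'.toPath γ.toPath) * _ = _
        rw [m_trans]; group }
  have hφ : ∀ q : Coords, q.disc ≠ 0 → label L.w L.e L.p L.m L.u L.v q ∈ φ.range := by
    intro q hq
    obtain ⟨γ, hγ⟩ := loop q hq
    refine ⟨((Path.Homotopic.Quotient.mk δ).trans γ).trans (Path.Homotopic.Quotient.mk δ).symm, ?_⟩
    change m _ _ (.mk δ) * m _ _ (((Path.Homotopic.Quotient.mk δ).trans γ).trans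
      (Path.Homotopic.Quotient.mk δ).symm) * (m _ _ (.mk δ))⁻¹ = _
    rw [m_trans, m_trans, m_symm, hγ]; group
  refine ⟨φ, ?_, ?_⟩
  · convert hφ (0, 0, 0, 1) (by simp [disc, rad])
    norm_num [label, disc, rad, L]
  · convert hφ (0, 0, 0, -1) (by simp [disc, rad])
    norm_num [label, disc, rad, L]

end KnotCoordinates

/-- The coordinates of a point of the sphere. -/
def sphereCoords (p : ThreeSphere) : Coords := (p.1 0, p.1 1, p.1 2, p.1 3)

theorem continuous_sphereCoords : Continuous sphereCoords := by
  unfold sphereCoords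
  fun_prop

theorem sphereCoords_mem_offKnot_iff (p : ThreeSphere) :
    sphereCoords p ∈ offKnot ↔ p ∉ standardFigureEight := by
  constructor
  · rintro h ⟨t, ht⟩
    have hk : 0 ≤ ‖figureEightParam t‖⁻¹ := by positivity
    set k := ‖figureEightParam t‖⁻¹
    have e : sphereCoords p = k • ((Real.cos (2 * t), Real.sin (4 * t), Real.cos (3 * t),
        Real.sin (3 * t)) : Coords) := by
      simp [sphereCoords, ht, figureEightParam]
    have hr : (sphereCoords p).rad = k := by
      rw [e, rad_smul hk]
      simp [rad]
    refine h t ⟨?_, ?_, ?_⟩ ?_ <;> rw [hr, e] <;> simp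
  · intro h t ht hy
    refine h ⟨t, ?_⟩
    set r := (sphereCoords p).rad
    have hr : 0 ≤ r := rad_nonneg _
    have e : (p : EuclideanSpace ℝ (Fin 4)) = r • figureEightParam t := by
      ext i
      fin_cases i
      · simpa [figureEightParam] using! ht.1
      · simpa [figureEightParam] using! hy
      · simpa [figureEightParam] using! ht.2.1
      · simpa [figureEightParam] using! ht.2.2
    have hn : ‖(p : EuclideanSpace ℝ (Fin 4))‖ = 1 := by simp
    rw [e, norm_smul, Real.norm_of_nonneg hr] at hn
    rw [e, eq_inv_of_mul_eq_one_left hn]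

/-- Radial projection of the cone over the complement. -/
noncomputable def sphereProj (q : offKnot) : ThreeSphere :=
  ⟨‖(!₂[q.1.1, q.1.2.1, q.1.2.2.1, q.1.2.2.2] : EuclideanSpace ℝ (Fin 4))‖⁻¹ •
    !₂[q.1.1, q.1.2.1, q.1.2.2.1, q.1.2.2.2], by
      rw [mem_sphere_zero_iff_norm, norm_smul, norm_inv, norm_norm]
      refine inv_mul_cancel₀ (norm_ne_zero_iff.2 fun h => ?_)
      have h0 := congrArg (fun z : EuclideanSpace ℝ (Fin 4) => z 0) h
      have h1 := congrArg (fun z : EuclideanSpace ℝ (Fin 4) => z 1) h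
      have h2 := congrArg (fun z : EuclideanSpace ℝ (Fin 4) => z 2) h
      have h3 := congrArg (fun z : EuclideanSpace ℝ (Fin 4) => z 3) h
      simp at h0 h1 h2 h3
      refine q.2 0 ⟨?_, ?_, ?_⟩ ?_ <;> simp [rad, h0, h1, h2, h3]⟩

theorem norm_ne_zero_of_offKnot (q : offKnot) :
    ‖(!₂[q.1.1, q.1.2.1, q.1.2.2.1, q.1.2.2.2] : EuclideanSpace ℝ (Fin 4))‖ ≠ 0 := by
  intro h
  have := (sphereProj q).2
  simp [sphereProj, h] at this

theorem continuous_sphereProj : Continuous sphereProj := by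
  refine Continuous.subtype_mk (Continuous.smul (Continuous.inv₀ ?_ norm_ne_zero_of_offKnot) ?_) _
  · refine Continuous.norm ((PiLp.continuous_toLp 2 _).comp (continuous_pi fun i => ?_))
    fin_cases i <;> simp <;> fun_prop
  · refine (PiLp.continuous_toLp 2 _).comp (continuous_pi fun i => ?_)
    fin_cases i <;> simp <;> fun_prop

theorem sphereCoords_sphereProj (q : offKnot) : ∃ k : ℝ, 0 < k ∧
    sphereCoords (sphereProj q) = k • q.1 :=
  ⟨_, inv_pos.2 (lt_of_le_of_ne (norm_nonneg _) (norm_ne_zero_of_offKnot q).symm), by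
    simp [sphereCoords, sphereProj]; rfl⟩

theorem smul_mem_offKnot {k : ℝ} (hk : 0 < k) {q : Coords} (h : q ∈ offKnot) :
    k • q ∈ offKnot := by
  intro t ht e
  refine h t ((over_smul_iff hk q t).1 ht) ?_
  rw [rad_smul hk.le, mul_assoc] at e
  exact mul_left_cancel₀ hk.ne' e

/-- The complement of a figure-eight knot carries knot coordinates. -/
theorem IsFigureEightKnot.exists_knotCoordinates {K : Set ThreeSphere}
    (hK : IsFigureEightKnot K) : Nonempty (KnotCoordinates ↥(Kᶜ)) := by
  obtain ⟨h, rfl⟩ := hK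
  have hc : ∀ y : ↥((h '' standardFigureEight)ᶜ), sphereCoords (h.symm y.1) ∈ offKnot := by
    intro y
    rw [sphereCoords_mem_offKnot_iff]
    intro hy
    exact y.2 ⟨_, hy, h.apply_symm_apply _⟩
  have hp : ∀ q : offKnot, sphereProj q ∉ standardFigureEight := by
    intro q
    rw [← sphereCoords_mem_offKnot_iff]
    obtain ⟨k, hk, e⟩ := sphereCoords_sphereProj q
    rw [e]
    exact smul_mem_offKnot hk q.2
  refine ⟨{
    coord := ⟨fun y => sphereCoords (h.symm y.1), continuous_sphereCoords.comp
      (h.symm.continuous.comp continuous_subtype_val)⟩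
    coord_mem := hc
    proj := ⟨fun q => ⟨h (sphereProj q), fun ⟨z, hz, e⟩ => hp q (h.injective e ▸ hz)⟩,
      (h.continuous.comp continuous_sphereProj).subtype_mk _⟩
    coord_proj := fun q => ?_
    proj_coord := fun y => ?_ }⟩
  · simpa using sphereCoords_sphereProj q
  · apply Subtype.ext
    change h (sphereProj ⟨sphereCoords (h.symm y.1), hc y⟩) = y.1
    rw [← h.eq_symm_apply]
    have e : (!₂[(h.symm y.1).1 0, (h.symm y.1).1 1, (h.symm y.1).1 2, (h.symm y.1).1 3] :
        EuclideanSpace ℝ (Fin 4)) = (h.symm y.1).1 := by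
      ext i; fin_cases i <;> rfl
    apply Subtype.ext
    change ‖(!₂[(h.symm y.1).1 0, (h.symm y.1).1 1, (h.symm y.1).1 2, (h.symm y.1).1 3] :
        EuclideanSpace ℝ (Fin 4))‖⁻¹ • (!₂[(h.symm y.1).1 0, (h.symm y.1).1 1, (h.symm y.1).1 2,
          (h.symm y.1).1 3] : EuclideanSpace ℝ (Fin 4)) = _
    rw [e]
    simp

/-- Representations of the group of the figure-eight knot from solutions of its relation. -/
theorem IsFigureEightKnot.exists_hom {K : Set ThreeSphere} (hK : IsFigureEightKnot K)
    (x : ↥(Kᶜ)) {Γ : Type*} [Group Γ] (U V : Γ)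
    (hUV : V * U * V⁻¹ * U * V = U * V * U⁻¹ * V * U) :
    ∃ φ : KnotGroup K x →* Γ, U ∈ φ.range ∧ V ∈ φ.range :=
  hK.exists_knotCoordinates.some.exists_hom U V hUV x

end Complement

/-! ### Chains of primes from analytic families. -/

section CharacterVarietyDimension

open Topology Set Matrix

/-- A chain of primes lies in an irreducible component of dimension at least its length. -/
theorem PrimeSpectrum.exists_irreducibleComponent_of_strictMono {R : Type*} [CommRing R] {d : ℕ}
    (P : Fin (d + 1) → PrimeSpectrum R) (hP : StrictMono P) :
    ∃ C ∈ irreducibleComponents (PrimeSpectrum R), (d : WithBot ℕ∞) ≤ topologicalKrullDim C ∧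
      ∀ i, P i ∈ C := by
  obtain ⟨C, hC, hPC⟩ := exists_mem_irreducibleComponents_subset_of_isIrreducible
    (closure {P 0}) isIrreducible_singleton.closure
  have hmem : ∀ i, P i ∈ C := fun i => hPC <| by
    rw [← specializes_iff_mem_closure, ← PrimeSpectrum.le_iff_specializes]
    exact hP.monotone (Fin.zero_le i)
  refine ⟨C, hC, ?_, hmem⟩
  -- Larger primes have smaller closures, so the chain of closed sets runs backwards.
  let x : Fin (d + 1) → C := fun i => ⟨P i.rev, hmem _⟩
  have hx : ∀ i j, x i ⤳ x j ↔ P i.rev ≤ P j.rev := fun i j => by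
    rw [PrimeSpectrum.le_iff_specializes, subtype_specializes_iff]
  let s : LTSeries (TopologicalSpace.IrreducibleCloseds C) :=
    LTSeries.mk d (fun i => ⟨closure {x i}, isIrreducible_singleton.closure, isClosed_closure⟩) <| by
      refine Fin.strictMono_iff_lt_succ.2 fun i => ?_
      have hlt : P i.succ.rev < P i.castSucc.rev :=
        hP (Fin.rev_lt_rev.2 (Fin.castSucc_lt_succ (i := i)))
      rw [lt_iff_le_not_ge]
      constructor
      · change closure {x i.castSucc} ⊆ closure {x i.succ}
        rw [← specializes_iff_closure_subset, hx]
        exact hlt.le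
      · change ¬ closure {x i.succ} ⊆ closure {x i.castSucc}
        rw [← specializes_iff_closure_subset, hx]
        exact not_le_of_gt hlt
  exact Order.LTSeries.length_le_krullDim s

/-- Near a point where `f` is nonzero `g` vanishes, and the identity theorem spreads this over `U`.
It is what makes the ideals of the slices prime. -/
theorem AnalyticOnNhd.eqOn_zero_or_eqOn_zero_of_mul {E : Type*} [NormedAddCommGroup E]
    [NormedSpace ℂ E] {f g : E → ℂ} {U : Set E} (hg : AnalyticOnNhd ℂ g U)
    (hf : ContinuousOn f U) (hU : IsOpen U) (hc : IsPreconnected U) (h : ∀ x ∈ U, f x * g x = 0) :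
    (∀ x ∈ U, f x = 0) ∨ ∀ x ∈ U, g x = 0 := by
  by_contra! hh
  obtain ⟨⟨x, hx, hfx⟩, y, hy, hgy⟩ := hh
  refine hgy (hg.eqOn_zero_of_preconnected_of_eventuallyEq_zero hc hx ?_ hy)
  filter_upwards [(hf.continuousAt (hU.mem_nhds hx)).eventually_ne hfx, hU.mem_nhds hx] with z h1 h2
  exact (mul_eq_zero.1 (h z h2)).resolve_left h1

variable {G : Type} [Group G] {N : ℕ}

/-- The trace of the image of `g`, minus a constant. -/
noncomputable def traceInvariant (g : G) (c : ℂ) : repInvariantRing G N :=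
  ⟨fun ρ => (ρ g : Matrix (Fin N) (Fin N) ℂ).trace - c, by
    refine ⟨?_, fun A ρ => ?_⟩
    · have : (fun ρ : SLRep G N => (ρ g : Matrix (Fin N) (Fin N) ℂ).trace - c) =
          (∑ i, fun ρ : SLRep G N => (ρ g : Matrix (Fin N) (Fin N) ℂ) i i) -
            algebraMap ℂ (SLRep G N → ℂ) c := by
        ext ρ
        simp [Matrix.trace]
      rw [this]
      exact sub_mem (sum_mem fun i _ => Algebra.subset_adjoin ⟨g, i, i, rfl⟩)
        (algebraMap_mem _ c)
    · change ((A * ρ g * A⁻¹ : Matrix.SpecialLinearGroup (Fin N) ℂ) :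
        Matrix (Fin N) (Fin N) ℂ).trace - c = _
      rw [Matrix.SpecialLinearGroup.coe_mul, Matrix.SpecialLinearGroup.coe_mul, Matrix.trace_mul_comm, ← mul_assoc, ← Matrix.SpecialLinearGroup.coe_mul, inv_mul_cancel,
        Matrix.SpecialLinearGroup.coe_one, one_mul]⟩

theorem analyticAt_repCoordinateRing {E : Type*} [NormedAddCommGroup E] [NormedSpace ℂ E]
    {σ : E → SLRep G N}
    (hσ : ∀ g i j s, AnalyticAt ℂ (fun s => (σ s g : Matrix (Fin N) (Fin N) ℂ) i j) s)
    {f : SLRep G N → ℂ} (hf : f ∈ repCoordinateRing G N) (s : E) :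
    AnalyticAt ℂ (fun s => f (σ s)) s := by
  induction hf using Algebra.adjoin_induction with
  | mem f hf => obtain ⟨g, i, j, rfl⟩ := hf; exact hσ g i j s
  | algebraMap c => exact analyticAt_const
  | add f g _ _ hf hg => exact hf.add hg
  | mul f g _ _ hf hg => exact hf.mul hg

/-- An analytic family of representations on which some traces are local coordinates gives a
component of the character variety of large dimension. -/
theorem exists_component_of_family {d : ℕ} (σ : (Fin d → ℂ) → SLRep G N)
    (hσ : ∀ g i j s, AnalyticAt ℂ (fun s => (σ s g : Matrix (Fin N) (Fin N) ℂ) i j) s)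
    (g : Fin d → G) (F' : (Fin d → ℂ) ≃L[ℂ] (Fin d → ℂ))
    (hF' : HasFDerivAt (fun s k => (σ s (g k) : Matrix (Fin N) (Fin N) ℂ).trace)
      (F' : (Fin d → ℂ) →L[ℂ] (Fin d → ℂ)) 0) :
    ∃ C ∈ irreducibleComponents (CharacterVariety G N), (d : WithBot ℕ∞) ≤ topologicalKrullDim C ∧
      (σ 0).character ∈ C := by
  let c : Fin d → ℂ := fun k => (σ 0 (g k) : Matrix (Fin N) (Fin N) ℂ).trace
  let F : (Fin d → ℂ) → (Fin d → ℂ) := fun s k => ((traceInvariant (N := N) (g k) (c k)).1 (σ s))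
  have hF0 : F 0 = 0 := by ext k; simp [F, traceInvariant, c]
  have hFan : ∀ s, AnalyticAt ℂ F s := fun s => by
    rw [analyticAt_pi_iff]
    exact fun k => analyticAt_repCoordinateRing hσ (traceInvariant (g k) (c k)).2.1 s
  have hFd : HasFDerivAt F (F' : (Fin d → ℂ) →L[ℂ] (Fin d → ℂ)) 0 := hF'.sub_const c
  have hcd : ContDiffAt ℂ 1 F 0 := (hFan 0).contDiffAt
  let e := hcd.toOpenPartialHomeomorph F hFd one_ne_zero
  have he : ∀ s, e s = F s := fun s => rfl
  have h0s : (0 : Fin d → ℂ) ∈ e.source := hcd.mem_toOpenPartialHomeomorph_source hFd one_ne_zero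
  have h0t : (0 : Fin d → ℂ) ∈ e.target := by
    have := e.map_source h0s
    rwa [he, hF0] at this
  have hsymm0 : e.symm 0 = 0 := by
    have := e.left_inv h0s
    rwa [he, hF0] at this
  have hinv : AnalyticAt ℂ e.symm 0 :=
    e.analyticAt_symm (i := F') h0t (by rw [hsymm0]; exact hFan 0)
      (by rw [hsymm0]; exact hFd.fderiv)
  obtain ⟨r, hr, hball⟩ := Metric.eventually_nhds_iff_ball.1
    (hinv.eventually_analyticAt.and (e.open_target.mem_nhds h0t))
  -- `pr i` sets the first `i` coordinates to zero. Coordinates are the values of the traces, via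
  -- the local inverse `e.symm`.
  let pr : ℕ → (Fin d → ℂ) →L[ℂ] (Fin d → ℂ) := fun i => ContinuousLinearMap.pi fun k =>
    if (k : ℕ) < i then 0 else ContinuousLinearMap.proj k
  have hpr : ∀ i y k, pr i y k = if (k : ℕ) < i then 0 else y k := by
    intro i y k
    by_cases h : (k : ℕ) < i <;> simp [pr, h]
  have hprball : ∀ i, ∀ y ∈ Metric.ball (0 : Fin d → ℂ) r, pr i y ∈ Metric.ball 0 r := by
    intro i y hy
    rw [mem_ball_zero_iff] at hy ⊢
    refine lt_of_le_of_lt ((pi_norm_le_iff_of_nonneg (norm_nonneg y)).2 fun k => ?_) hy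
    rw [hpr]
    split_ifs
    · simp
    · exact norm_le_pi_norm y k
  have hprpr : ∀ {i j : ℕ}, i ≤ j → ∀ y, pr i (pr j y) = pr j y := by
    intro i j hij y
    ext k
    rw [hpr, hpr]
    split_ifs <;> first | rfl | lia
  have han : ∀ (i : ℕ) (f : repInvariantRing G N),
      AnalyticOnNhd ℂ (fun y => f.1 (σ (e.symm (pr i y)))) (Metric.ball 0 r) := by
    intro i f y hy
    have h1 := analyticAt_repCoordinateRing hσ f.2.1 (e.symm (pr i y))
    have h2 := (hball _ (hprball i y hy)).1
    exact (h1.comp_of_eq h2 rfl).comp_of_eq ((pr i).analyticAt y) rfl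
  let I : ℕ → Ideal (repInvariantRing G N) := fun i =>
    { carrier := {f | ∀ y ∈ Metric.ball (0 : Fin d → ℂ) r, f.1 (σ (e.symm (pr i y))) = 0}
      add_mem' := fun {a b} ha hb y hy => by
        change a.1 _ + b.1 _ = 0
        rw [ha y hy, hb y hy, add_zero]
      zero_mem' := fun y _ => rfl
      smul_mem' := fun a b hb y hy => by
        change a.1 _ * b.1 _ = 0
        rw [hb y hy, mul_zero] }
  have hIp : ∀ i, (I i).IsPrime := by
    intro i
    refine ⟨fun h => ?_, fun {a b} hab => ?_⟩
    · have h1 : (1 : repInvariantRing G N) ∈ I i := by rw [h]; trivial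
      exact one_ne_zero (h1 0 (Metric.mem_ball_self hr))
    · exact (han i b).eqOn_zero_or_eqOn_zero_of_mul (han i a).continuousOn Metric.isOpen_ball
        (convex_ball 0 r).isPreconnected hab
  let P : Fin (d + 1) → CharacterVariety G N := fun i => ⟨I i, hIp i⟩
  have hP : StrictMono P := by
    refine Fin.strictMono_iff_lt_succ.2 fun i => ?_
    change I i < I (i + 1)
    refine lt_of_le_not_ge (fun f hf y hy => ?_) fun hle => ?_
    · rw [← hprpr (Nat.le_succ i) y]
      exact hf _ (hprball _ _ hy)
    -- The coordinate with index `i` is itself an invariant; it vanishes on slice `i + 1` but not on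
    -- slice `i`.
    · have hval : ∀ j, ∀ y ∈ Metric.ball (0 : Fin d → ℂ) r,
          (traceInvariant (N := N) (g i) (c i)).1 (σ (e.symm (pr j y))) = pr j y i := by
        intro j y hy
        have := e.right_inv (hball _ (hprball j y hy)).2
        exact congr_fun this i
      have h1 : traceInvariant (g i) (c i) ∈ I i := hle fun y hy => by
        rw [hval _ y hy, hpr, if_pos (Nat.lt_succ_self _)]
      let y : Fin d → ℂ := fun _ => (r / 2 : ℝ)
      have hy : y ∈ Metric.ball (0 : Fin d → ℂ) r := by
        rw [mem_ball_zero_iff, pi_norm_lt_iff hr]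
        intro k
        rw [Complex.norm_real, Real.norm_of_nonneg (by positivity)]
        linarith
      have h2 := h1 y hy
      rw [hval _ y hy, hpr, if_neg (lt_irrefl _), Complex.ofReal_eq_zero] at h2
      linarith
  obtain ⟨C, hC, hdim, hmem⟩ := PrimeSpectrum.exists_irreducibleComponent_of_strictMono P hP
  refine ⟨C, hC, hdim, ?_⟩
  convert hmem (Fin.last d) using 1
  refine PrimeSpectrum.ext (Ideal.ext fun f => ?_)
  have hp0 : ∀ y, pr d y = 0 := fun y => by ext k; rw [hpr, if_pos k.2]; rfl
  change f.1 (σ 0) = 0 ↔ ∀ y ∈ Metric.ball (0 : Fin d → ℂ) r, f.1 (σ (e.symm (pr d y))) = 0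
  simp only [hp0, hsymm0]
  exact ⟨fun h _ _ => h, fun h => h 0 (Metric.mem_ball_self hr)⟩

end CharacterVarietyDimension

/-! ### Traces, cocycles and coboundaries. -/

section CharacterVarietyTangent

open Topology Set Matrix

/-- Derivations of a matrix algebra are inner. -/
theorem Matrix.exists_eq_commutator_of_derivation {n R : Type*} [Fintype n] [DecidableEq n]
    [CommRing R] [Nonempty n] (D : Matrix n n R →ₗ[R] Matrix n n R)
    (hD : ∀ a b, D (a * b) = D a * b + a * D b) :
    ∃ X : Matrix n n R, ∀ a, D a = X * a - a * X := by
  obtain ⟨o⟩ := ‹Nonempty n›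
  -- If `D` is the commutator with `Y`, this sum is `Y` minus the scalar `Y o o`.
  let X : Matrix n n R := ∑ i, D (single i o 1) * single o i 1
  have key : ∀ p q, D (single p q 1) = X * single p q 1 - single p q 1 * X := by
    intro p q
    have h1 : X * single p q 1 = D (single p o 1) * single o q 1 := by
      simp only [X, Finset.sum_mul, mul_assoc]
      rw [Finset.sum_eq_single p]
      · rw [single_mul_single_same, one_mul]
      · intro i _ hi
        rw [single_mul_single_of_ne (h := hi), mul_zero]
      · simp
    have h2 : single p q 1 * X = D (single p o 1) * single o q 1 - D (single p q 1) := by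
      have h3 : ∀ i, single p q 1 * (D (single i o 1) * single o i 1) =
          D (single p q 1 * single i o 1) * single o i 1 - D (single p q 1) * single i i 1 := by
        intro i
        rw [hD, add_mul, mul_assoc (D _), single_mul_single_same, one_mul, mul_assoc]
        abel
      simp only [X, Finset.mul_sum, h3, Finset.sum_sub_distrib]
      congr 1
      · rw [Finset.sum_eq_single q]
        · rw [single_mul_single_same, one_mul]
        · intro i _ hi
          rw [single_mul_single_of_ne (h := hi.symm), map_zero, zero_mul]
        · simp
      · rw [← Finset.mul_sum]
        have : ∑ i : n, single i i (1 : R) = 1 := by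
          rw [matrix_eq_sum_single (1 : Matrix n n R)]
          refine Finset.sum_congr rfl fun i _ => ?_
          rw [Finset.sum_eq_single i]
          · rw [one_apply_eq]
          · intro j _ hj
            rw [one_apply_ne hj.symm, single_zero]
          · simp
        rw [this, mul_one]
    rw [h1, h2]; abel
  refine ⟨X, fun a => ?_⟩
  have ha : a = ∑ p, ∑ q, a p q • single p q (1 : R) := by
    conv_lhs => rw [matrix_eq_sum_single a]
    simp [smul_single]
  rw [ha]
  simp only [map_sum, map_smul, key, Finset.mul_sum, Finset.sum_mul, Matrix.smul_mul,
    Matrix.mul_smul, smul_sub, Finset.sum_sub_distrib]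

/-- A cocycle all of whose traces vanish is a coboundary, if the representation spans the matrix
algebra. -/
theorem exists_coboundary_of_trace_eq_zero {G : Type*} [Group G] {N : ℕ} [NeZero N]
    (ρ u : G → Matrix (Fin N) (Fin N) ℂ) (hρ : ∀ g h, ρ (g * h) = ρ g * ρ h)
    (hu : ∀ g h, u (g * h) = u g * ρ h + ρ g * u h) (htr : ∀ g, (u g).trace = 0)
    (hspan : Submodule.span ℂ (range ρ) = ⊤) :
    ∃ X : Matrix (Fin N) (Fin N) ℂ, ∀ g, u g = X * ρ g - ρ g * X := by
  let Φ := Finsupp.linearCombination ℂ ρ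
  let Ψ := Finsupp.linearCombination ℂ u
  have hΦ : LinearMap.range Φ = ⊤ := by rw [Finsupp.range_linearCombination, hspan]
  -- The vanishing trace of `u (g * h)` says that `u` and `ρ` are skew-adjoint for the trace form.
  -- Since that form is nondegenerate and `ρ` spans, `ρ g ↦ u g` extends to a well-defined linear
  -- map, which turns out to be a derivation.
  have hker : ∀ z, Φ z = 0 → Ψ z = 0 := by
    intro z hz
    rw [Matrix.ext_iff_trace_mul_right]
    intro m
    rw [zero_mul, trace_zero]
    have hm : m ∈ Submodule.span ℂ (range ρ) := by rw [hspan]; trivial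
    induction hm using Submodule.span_induction with
    | zero => rw [mul_zero, trace_zero]
    | add a b _ _ ha hb => rw [mul_add, trace_add, ha, hb, add_zero]
    | smul c a _ ha => rw [Matrix.mul_smul, trace_smul, ha, smul_zero]
    | mem m hm =>
      obtain ⟨h, rfl⟩ := hm
      have e1 : ∀ z : G →₀ ℂ, (Ψ z * ρ h).trace = -(Φ z * u h).trace := by
        intro z
        induction z using Finsupp.induction_linear with
        | zero => simp
        | add a b ha hb => rw [map_add, map_add, add_mul, add_mul, trace_add, trace_add, ha, hb]; ring
        | single g c =>
          simp only [Φ, Ψ, Finsupp.linearCombination_single, Matrix.smul_mul, trace_smul]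
          have := htr (g * h)
          rw [hu, trace_add] at this
          rw [eq_neg_of_add_eq_zero_left this, smul_neg]
      rw [e1, hz, zero_mul, trace_zero, neg_zero]
  obtain ⟨s, hs⟩ := Φ.exists_rightInverse_of_surjective hΦ
  let D := Ψ ∘ₗ s
  have hDΦ : ∀ g, D (ρ g) = u g := by
    intro g
    have h1 : Φ (s (ρ g) - Finsupp.single g 1) = 0 := by
      rw [map_sub, show Φ (s (ρ g)) = ρ g from LinearMap.congr_fun hs (ρ g)]
      simp [Φ]
    have h2 := hker _ h1
    rw [map_sub, sub_eq_zero] at h2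
    change Ψ (s (ρ g)) = _
    rw [h2]
    simp [Ψ]
  have hD : ∀ a b, D (a * b) = D a * b + a * D b := by
    intro a b
    have ha : a ∈ Submodule.span ℂ (range ρ) := by rw [hspan]; trivial
    have hb : b ∈ Submodule.span ℂ (range ρ) := by rw [hspan]; trivial
    induction ha using Submodule.span_induction with
    | zero => simp
    | add a a' _ _ h h' => rw [add_mul, map_add, h, h', map_add, add_mul, add_mul]; abel
    | smul c a _ h => rw [Matrix.smul_mul, map_smul, h, map_smul, Matrix.smul_mul, Matrix.smul_mul,
        smul_add]
    | mem a ha =>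
      obtain ⟨g, rfl⟩ := ha
      induction hb using Submodule.span_induction with
      | zero => simp
      | add a a' _ _ h h' => rw [mul_add, map_add, h, h', map_add, mul_add, mul_add]; abel
      | smul c a _ h => rw [Matrix.mul_smul, map_smul, h, map_smul, Matrix.mul_smul,
          Matrix.mul_smul, smul_add]
      | mem b hb =>
        obtain ⟨h, rfl⟩ := hb
        rw [← hρ, hDΦ, hDΦ, hDΦ, hu]
  obtain ⟨X, hX⟩ := exists_eq_commutator_of_derivation D hD
  exact ⟨X, fun g => by rw [← hDΦ, hX]⟩

theorem SLRep.irreducible_of_span {G : Type} [Group G] {N : ℕ} (ρ : SLRep G N)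
    (h : Submodule.span ℂ (range fun g => (ρ g : Matrix (Fin N) (Fin N) ℂ)) = ⊤) :
    ρ.Irreducible := by
  intro V hV
  have hall : ∀ (m : Matrix (Fin N) (Fin N) ℂ), ∀ v ∈ V, m *ᵥ v ∈ V := by
    intro m
    have hm : m ∈ Submodule.span ℂ (range fun g => (ρ g : Matrix (Fin N) (Fin N) ℂ)) := by
      rw [h]; trivial
    induction hm using Submodule.span_induction with
    | zero => intro v _; rw [zero_mulVec]; exact zero_mem _
    | add a b _ _ ha hb => intro v hv; rw [add_mulVec]; exact add_mem (ha v hv) (hb v hv)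
    | smul c a _ ha => intro v hv; rw [smul_mulVec]; exact V.smul_mem c (ha v hv)
    | mem m hm => obtain ⟨g, rfl⟩ := hm; exact hV g
  by_cases hV0 : V = ⊥
  · exact .inl hV0
  right
  obtain ⟨v, hv, hv0⟩ := V.ne_bot_iff.1 hV0
  obtain ⟨i, hi⟩ := Function.ne_iff.1 hv0
  have hbasis : ∀ j, Pi.single j (1 : ℂ) ∈ V := by
    intro j
    have := hall (Matrix.single j i (v i)⁻¹) v hv
    rw [single_mulVec, inv_mul_cancel₀ hi] at this
    exact this
  rw [eq_top_iff]
  intro w _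
  rw [pi_eq_sum_univ' w]
  exact sum_mem fun j _ => by
    have := V.smul_mem (w j) (hbasis j)
    convert this using 1

/-- An analytic family of representations, whose central member spans the matrix algebra and no
tangent vector of which is a coboundary, gives a component of large dimension. -/
theorem exists_component_of_tangent {G : Type} [Group G] {N d : ℕ} [NeZero N]
    (σ : (Fin d → ℂ) → SLRep G N)
    (hσ : ∀ g i j s, AnalyticAt ℂ (fun s => (σ s g : Matrix (Fin N) (Fin N) ℂ) i j) s)
    (hspan : Submodule.span ℂ (range fun g => (σ 0 g : Matrix (Fin N) (Fin N) ℂ)) = ⊤)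
    (htan : ∀ (v : Fin d → ℂ) (X : Matrix (Fin N) (Fin N) ℂ),
      (∀ g, Matrix.of (fun i j => fderiv ℂ (fun s => (σ s g : Matrix (Fin N) (Fin N) ℂ) i j) 0 v) =
        X * (σ 0 g : Matrix (Fin N) (Fin N) ℂ) - (σ 0 g : Matrix (Fin N) (Fin N) ℂ) * X) → v = 0) :
    ∃ C ∈ irreducibleComponents (CharacterVariety G N), (d : WithBot ℕ∞) ≤ topologicalKrullDim C ∧
      ∃ ρ : SLRep G N, ρ.Irreducible ∧ ρ.character ∈ C := by
  have hdiff : ∀ g i j, HasFDerivAt (fun s => (σ s g : Matrix (Fin N) (Fin N) ℂ) i j)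
      (fderiv ℂ (fun s => (σ s g : Matrix (Fin N) (Fin N) ℂ) i j) 0) 0 :=
    fun g i j => (hσ g i j 0).differentiableAt.hasFDerivAt
  let ℓ : G → (Fin d → ℂ) →L[ℂ] ℂ := fun g =>
    ∑ i, fderiv ℂ (fun s => (σ s g : Matrix (Fin N) (Fin N) ℂ) i i) 0
  have hℓ : ∀ g, HasFDerivAt (fun s => (σ s g : Matrix (Fin N) (Fin N) ℂ).trace) (ℓ g) 0 :=
    fun g => HasFDerivAt.fun_sum fun i _ => hdiff g i i
  -- The derivative of a family of representations is a cocycle; if its traces vanish it is a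
  -- coboundary, which `htan` excludes unless `v = 0`. So the differentials of the traces have no
  -- common zero, and `d` of them form a basis of the dual space.
  have hsep : ∀ v, (∀ g, ℓ g v = 0) → v = 0 := by
    intro v hv
    let u : G → Matrix (Fin N) (Fin N) ℂ := fun g =>
      Matrix.of (fun i j => fderiv ℂ (fun s => (σ s g : Matrix (Fin N) (Fin N) ℂ) i j) 0 v)
    have hu : ∀ g h, u (g * h) = u g * (σ 0 h : Matrix (Fin N) (Fin N) ℂ) +
        (σ 0 g : Matrix (Fin N) (Fin N) ℂ) * u h := by
      intro g h
      refine Matrix.ext fun i j => ?_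
      have h1 : HasFDerivAt (fun s => (σ s (g * h) : Matrix (Fin N) (Fin N) ℂ) i j)
          (∑ k, ((σ 0 g : Matrix (Fin N) (Fin N) ℂ) i k •
            fderiv ℂ (fun s => (σ s h : Matrix (Fin N) (Fin N) ℂ) k j) 0 +
            (σ 0 h : Matrix (Fin N) (Fin N) ℂ) k j •
            fderiv ℂ (fun s => (σ s g : Matrix (Fin N) (Fin N) ℂ) i k) 0)) 0 := by
        have : (fun s => (σ s (g * h) : Matrix (Fin N) (Fin N) ℂ) i j) = fun s =>
            ∑ k, (σ s g : Matrix (Fin N) (Fin N) ℂ) i k *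
              (σ s h : Matrix (Fin N) (Fin N) ℂ) k j := by
          ext s; simp [Matrix.mul_apply]
        rw [this]
        exact HasFDerivAt.fun_sum fun k _ => (hdiff g i k).mul (hdiff h k j)
      simp only [u, of_apply, h1.fderiv, Matrix.add_apply, Matrix.mul_apply]
      simp only [_root_.sum_apply, _root_.add_apply,
        _root_.smul_apply, smul_eq_mul, Finset.sum_add_distrib]
      rw [add_comm]
      congr 1
      exact Finset.sum_congr rfl fun k _ => mul_comm _ _
    have htr : ∀ g, (u g).trace = 0 := by
      intro g
      rw [← hv g]
      simp [u, ℓ, Matrix.trace]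
    obtain ⟨X, hX⟩ := exists_coboundary_of_trace_eq_zero
      (fun g => (σ 0 g : Matrix (Fin N) (Fin N) ℂ)) u (fun g h => by simp) hu htr hspan
    exact htan v X hX
  have htop : Submodule.span ℂ (range fun g => (ℓ g : (Fin d → ℂ) →ₗ[ℂ] ℂ)) = ⊤ := by
    refine Submodule.span_eq_top_of_ne_zero fun z hz => ?_
    by_contra! hh
    exact hz (hsep z fun g => hh _ ⟨g, rfl⟩)
  obtain ⟨κ, a, -, hsp, hli⟩ :=
    exists_linearIndependent' ℂ (fun g => (ℓ g : (Fin d → ℂ) →ₗ[ℂ] ℂ))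
  rw [htop] at hsp
  let b := Module.Basis.mk hli hsp.ge
  have : Finite κ := Module.Finite.finite_basis b
  have : Fintype κ := Fintype.ofFinite κ
  have hcard : Fintype.card κ = d := by
    rw [← Module.finrank_eq_card_basis b]
    exact Subspace.dual_finrank_eq.trans (by simp)
  let ε : κ ≃ Fin d := Fintype.equivFinOfCardEq hcard
  let gs : Fin d → G := fun k => a (ε.symm k)
  let F : (Fin d → ℂ) →L[ℂ] (Fin d → ℂ) := ContinuousLinearMap.pi fun k => ℓ (gs k)
  have hFinj : Function.Injective F := by
    rw [injective_iff_map_eq_zero]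
    intro v hv
    refine hsep v fun g => ?_
    have hmem : (ℓ g : (Fin d → ℂ) →ₗ[ℂ] ℂ) ∈ Submodule.span ℂ
        (range ((fun g => (ℓ g : (Fin d → ℂ) →ₗ[ℂ] ℂ)) ∘ a)) := by rw [hsp]; trivial
    have hz : ∀ f ∈ Submodule.span ℂ (range ((fun g => (ℓ g : (Fin d → ℂ) →ₗ[ℂ] ℂ)) ∘ a)),
        f v = 0 := by
      intro f hf
      induction hf using Submodule.span_induction with
      | zero => rfl
      | add f f' _ _ h h' => rw [LinearMap.add_apply, h, h', add_zero]
      | smul c f _ h => rw [LinearMap.smul_apply, h, smul_zero]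
      | mem f hf =>
        obtain ⟨k, rfl⟩ := hf
        have := congr_fun hv (ε k)
        simpa [F, gs] using this
    exact hz _ hmem
  let F' : (Fin d → ℂ) ≃L[ℂ] (Fin d → ℂ) :=
    (LinearEquiv.ofInjectiveEndo F.toLinearMap hFinj).toContinuousLinearEquiv
  have hFF' : (F' : (Fin d → ℂ) →L[ℂ] (Fin d → ℂ)) = F := by ext v : 1; rfl
  obtain ⟨C, hC, hdim, hmem⟩ := exists_component_of_family σ hσ gs F' (by
    rw [hFF', hasFDerivAt_pi']
    exact fun k => hℓ (gs k))
  exact ⟨C, hC, hdim, σ 0, (σ 0).irreducible_of_span hspan, hmem⟩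

end CharacterVarietyTangent

/-! ### Block monomial matrices and the induced representation. -/

section BlockMonomial

open Matrix

variable {m N : ℕ} {R : Type*} [CommRing R]

/-- The matrix with blocks `A k l`. -/
def blockEquiv (e : Fin 5 × Fin m ≃ Fin N) :
    Matrix (Fin 5) (Fin 5) (Matrix (Fin m) (Fin m) R) ≃ₐ[R] Matrix (Fin N) (Fin N) R :=
  (compAlgEquiv (Fin 5) (Fin m) R R).trans (reindexAlgEquiv R R e)

theorem blockEquiv_apply (e : Fin 5 × Fin m ≃ Fin N)
    (A : Matrix (Fin 5) (Fin 5) (Matrix (Fin m) (Fin m) R)) (k l : Fin 5) (i j : Fin m) :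
    blockEquiv e A (e (k, i)) (e (l, j)) = A k l i j := by
  simp [blockEquiv, compAlgEquiv]

/-- The block monomial matrix whose only block in row `k` is `d k`, in column `π k`. -/
def blockMonomial {S : Type*} [Semiring S] (d : Fin 5 → S) (π : Equiv.Perm (Fin 5)) :
    Matrix (Fin 5) (Fin 5) S :=
  Matrix.of fun k l => if π k = l then d k else 0

theorem blockMonomial_eq {S : Type*} [Semiring S] (d : Fin 5 → S) {π : Equiv.Perm (Fin 5)}
    {k l : Fin 5} (h : π k = l) : blockMonomial d π k l = d k :=
  if_pos h

theorem blockMonomial_ne {S : Type*} [Semiring S] (d : Fin 5 → S) {π : Equiv.Perm (Fin 5)}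
    {k l : Fin 5} (h : π k ≠ l) : blockMonomial d π k l = 0 :=
  if_neg h

theorem blockMonomial_mul {S : Type*} [Semiring S] (d d' : Fin 5 → S)
    (π π' : Equiv.Perm (Fin 5)) :
    blockMonomial d π * blockMonomial d' π' =
      blockMonomial (fun k => d k * d' (π k)) (π' * π) := by
  ext k l
  rw [Matrix.mul_apply, Finset.sum_eq_single (π k), blockMonomial_eq d rfl]
  · by_cases h : π' (π k) = l
    · rw [blockMonomial_eq _ h, blockMonomial_eq _ (show (π' * π) k = l from h)]
    · rw [blockMonomial_ne _ h, blockMonomial_ne _ (show (π' * π) k ≠ l from h), mul_zero]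
  · intro j _ hj
    rw [blockMonomial_ne d hj.symm, zero_mul]
  · exact fun h => absurd (Finset.mem_univ _) h

theorem blockMonomial_one {S : Type*} [Semiring S] :
    blockMonomial (fun _ => (1 : S)) 1 = 1 := by
  ext k l
  by_cases h : k = l
  · rw [one_apply, if_pos h, blockMonomial_eq _ h]
  · rw [one_apply_ne h, blockMonomial_ne _ h]

/-- The matrix is block diagonal times a permutation matrix tensored with the identity of size `m`,
whence the power of the sign. -/
theorem det_blockMonomial (e : Fin 5 × Fin m ≃ Fin N)
    (d : Fin 5 → Matrix (Fin m) (Fin m) R) (π : Equiv.Perm (Fin 5)) :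
    (blockEquiv e (blockMonomial d π)).det =
      ((Equiv.Perm.sign π : ℤ) : R) ^ m * ∏ k, (d k).det := by
  have h1 : blockMonomial d π = blockMonomial d 1 * blockMonomial (fun _ => 1) π := by
    rw [blockMonomial_mul]
    simp
  have h2 : (blockEquiv e (blockMonomial d 1)).det = ∏ k, (d k).det := by
    rw [← det_blockDiagonal]
    rw [← det_submatrix_equiv_self ((Equiv.prodComm (Fin m) (Fin 5)).trans e)]
    congr 1
    ext ⟨i, k⟩ ⟨j, l⟩
    simp only [submatrix_apply, Equiv.trans_apply, Equiv.prodComm_apply, Prod.swap_prod_mk,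
      blockEquiv_apply]
    by_cases h : k = l
    · rw [blockMonomial_eq _ h, ← h, blockDiagonal_apply_eq]
    · rw [blockDiagonal_apply_ne _ _ _ h, blockMonomial_ne _ h, Matrix.zero_apply]
  have h3 : (blockEquiv e (blockMonomial (fun _ => (1 : Matrix (Fin m) (Fin m) R)) π)).det =
      ((Equiv.Perm.sign π : ℤ) : R) ^ m := by
    rw [← det_submatrix_equiv_self e]
    have : (blockEquiv e (blockMonomial (fun _ => (1 : Matrix (Fin m) (Fin m) R)) π)).submatrix e e =
        kroneckerMap (fun a b => a * b) (π.permMatrix R) (1 : Matrix (Fin m) (Fin m) R) := by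
      ext ⟨k, i⟩ ⟨l, j⟩
      simp only [submatrix_apply, blockEquiv_apply, kroneckerMap_apply, Equiv.Perm.permMatrix,
        PEquiv.toMatrix_apply, Equiv.toPEquiv_apply, Option.mem_def, Option.some.injEq]
      by_cases h : π k = l
      · rw [blockMonomial_eq _ h, if_pos h, one_mul]
      · rw [blockMonomial_ne _ h, if_neg h, zero_mul, Matrix.zero_apply]
    rw [this, det_kronecker, det_permutation, det_one, one_pow, mul_one, Fintype.card_fin]
  rw [h1, map_mul, det_mul, h2, h3, mul_comm]

/-- Block monomial matrices with blocks in `SL(m)`, for even `m`, as elements of `SL(N)`. -/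
def slMonomial (hm : Even m) (e : Fin 5 × Fin m ≃ Fin N)
    (d : Fin 5 → Matrix.SpecialLinearGroup (Fin m) R) (π : Equiv.Perm (Fin 5)) :
    Matrix.SpecialLinearGroup (Fin N) R :=
  ⟨blockEquiv e (blockMonomial (fun k => (d k : Matrix (Fin m) (Fin m) R)) π), by
    rw [det_blockMonomial, Finset.prod_eq_one fun k _ => (d k).2, mul_one]
    rcases Int.units_eq_one_or (Equiv.Perm.sign π) with h | h <;> simp [h, hm.neg_one_pow]⟩

variable (hm : Even m) (e : Fin 5 × Fin m ≃ Fin N)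

theorem slMonomial_mul (d d' : Fin 5 → Matrix.SpecialLinearGroup (Fin m) R)
    (π π' : Equiv.Perm (Fin 5)) :
    slMonomial hm e d π * slMonomial hm e d' π' =
      slMonomial hm e (fun k => d k * d' (π k)) (π' * π) := by
  apply Subtype.ext
  change blockEquiv e _ * blockEquiv e _ = blockEquiv e _
  rw [← map_mul, blockMonomial_mul]
  rfl

theorem slMonomial_one : slMonomial (R := R) hm e (fun _ => 1) 1 = 1 := by
  apply Subtype.ext
  change blockEquiv e (blockMonomial (fun _ => 1) 1) = 1
  rw [blockMonomial_one, map_one]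

theorem slMonomial_inv (d : Fin 5 → Matrix.SpecialLinearGroup (Fin m) R)
    (π : Equiv.Perm (Fin 5)) :
    (slMonomial hm e d π)⁻¹ = slMonomial hm e (fun k => (d (π⁻¹ k))⁻¹) π⁻¹ := by
  rw [inv_eq_iff_mul_eq_one, slMonomial_mul, ← slMonomial_one hm e]
  simp

theorem slMonomial_map {R' : Type*} [CommRing R'] (f : R →+* R')
    (d : Fin 5 → Matrix.SpecialLinearGroup (Fin m) R) (π : Equiv.Perm (Fin 5)) :
    Matrix.SpecialLinearGroup.map f (slMonomial hm e d π) =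
      slMonomial hm e (fun k => Matrix.SpecialLinearGroup.map f (d k)) π := by
  apply Subtype.ext
  ext a b
  obtain ⟨⟨k, i⟩, rfl⟩ := e.surjective a
  obtain ⟨⟨l, j⟩, rfl⟩ := e.surjective b
  change f (blockEquiv e _ _ _) = blockEquiv e _ _ _
  rw [blockEquiv_apply, blockEquiv_apply]
  by_cases h : π k = l
  · rw [blockMonomial_eq _ h, blockMonomial_eq _ h]
    rfl
  · rw [blockMonomial_ne _ h, blockMonomial_ne _ h, Matrix.zero_apply, Matrix.zero_apply, map_zero]

/-- The permutation underlying the first generator. -/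
def permU : Equiv.Perm (Fin 5) := Equiv.swap 1 2 * Equiv.swap 3 4

/-- The permutation underlying the second generator. -/
def permV : Equiv.Perm (Fin 5) := Equiv.swap 0 1 * Equiv.swap 2 3

/-- The image of the first generator of the knot group under the representation induced from a
subgroup of index `5` which maps onto the free group on `x` and `q`. -/
def monomialU (x q : Matrix.SpecialLinearGroup (Fin m) R) : Matrix.SpecialLinearGroup (Fin N) R :=
  slMonomial hm e ![1, 1, x, 1, x * q * x⁻¹] permU

/-- The image of the second generator. -/
def monomialV (x q : Matrix.SpecialLinearGroup (Fin m) R) : Matrix.SpecialLinearGroup (Fin N) R :=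
  slMonomial hm e ![1, q, 1, x, 1] permV

theorem permU_inv : permU⁻¹ = permU := by decide

theorem permV_inv : permV⁻¹ = permV := by decide

theorem permU_apply : permU 0 = 0 ∧ permU 1 = 2 ∧ permU 2 = 1 ∧ permU 3 = 4 ∧ permU 4 = 3 := by
  decide

theorem permV_apply : permV 0 = 1 ∧ permV 1 = 0 ∧ permV 2 = 3 ∧ permV 3 = 2 ∧ permV 4 = 4 := by
  decide

theorem slMonomial_congr {d d' : Fin 5 → Matrix.SpecialLinearGroup (Fin m) R}
    {π π' : Equiv.Perm (Fin 5)} (h0 : d 0 = d' 0) (h1 : d 1 = d' 1) (h2 : d 2 = d' 2)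
    (h3 : d 3 = d' 3) (h4 : d 4 = d' 4) (hπ : π = π') :
    slMonomial hm e d π = slMonomial hm e d' π' := by
  have : d = d' := by
    ext1 k
    fin_cases k <;> assumption
  rw [this, hπ]

/-- The permutations are reflections of a pentagon, with product of order 5, so the two sides have
equal underlying permutations. The five block entries agree as words in the free group on `x` and
`q`. No property of the ring is used, so entire functions are allowed. -/
theorem monomial_relation (x q : Matrix.SpecialLinearGroup (Fin m) R) :
    monomialV hm e x q * monomialU hm e x q * (monomialV hm e x q)⁻¹ * monomialU hm e x q *
      monomialV hm e x q = monomialU hm e x q * monomialV hm e x q * (monomialU hm e x q)⁻¹ *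
      monomialV hm e x q * monomialU hm e x q := by
  obtain ⟨u0, u1, u2, u3, u4⟩ := permU_apply
  obtain ⟨v0, v1, v2, v3, v4⟩ := permV_apply
  simp only [monomialU, monomialV, slMonomial_inv, slMonomial_mul, permU_inv, permV_inv]
  apply slMonomial_congr
  case hπ => decide
  all_goals
    simp [u0, u1, u2, u3, u4, v0, v1, v2, v3, v4]
    try group

/-- This word and the conjugated square of the other generator below are block diagonal; their first
blocks recover `q` and `x`. -/
theorem monomial_sq_v (x q : Matrix.SpecialLinearGroup (Fin m) R) :
    monomialV hm e x q * monomialV hm e x q = slMonomial hm e ![q, q, x, x, 1] 1 := by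
  obtain ⟨u0, u1, u2, u3, u4⟩ := permU_apply
  obtain ⟨v0, v1, v2, v3, v4⟩ := permV_apply
  simp only [monomialV, slMonomial_mul]
  apply slMonomial_congr
  case hπ => decide
  all_goals simp [v0, v1, v2, v3, v4]

theorem monomial_sq_u (x q : Matrix.SpecialLinearGroup (Fin m) R) :
    monomialU hm e x q * monomialU hm e x q =
      slMonomial hm e ![1, x, x, x * q * x⁻¹, x * q * x⁻¹] 1 := by
  obtain ⟨u0, u1, u2, u3, u4⟩ := permU_apply
  obtain ⟨v0, v1, v2, v3, v4⟩ := permV_apply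
  simp only [monomialU, slMonomial_mul]
  apply slMonomial_congr
  case hπ => decide
  all_goals simp [u0, u1, u2, u3, u4]

theorem monomial_conj_sq_u (x q : Matrix.SpecialLinearGroup (Fin m) R) :
    monomialV hm e x q * (monomialU hm e x q * monomialU hm e x q) * (monomialV hm e x q)⁻¹ =
      slMonomial hm e ![x, 1, x * q * x⁻¹, x * x * x⁻¹, x * q * x⁻¹] 1 := by
  obtain ⟨u0, u1, u2, u3, u4⟩ := permU_apply
  obtain ⟨v0, v1, v2, v3, v4⟩ := permV_apply
  rw [monomial_sq_u]
  simp only [monomialV, slMonomial_inv, slMonomial_mul, permV_inv]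
  apply slMonomial_congr
  case hπ => decide
  all_goals simp [v0, v1, v2, v3, v4]

end BlockMonomial

/-! ### Generation of the full matrix algebra. -/

section Generation

open Matrix

theorem aeval_pi_apply {ι K A : Type*} [Field K] [Ring A] [Algebra K A] (d : ι → A)
    (f : Polynomial K) (k : ι) : Polynomial.aeval d f k = Polynomial.aeval (d k) f :=
  (Polynomial.aeval_algHom_apply (Pi.evalAlgHom K (fun _ : ι => A) k) d f).symm

theorem aeval_diagonal {ι K A : Type*} [Field K] [Ring A] [Algebra K A] [Fintype ι]
    [DecidableEq ι] (d : ι → A) (f : Polynomial K) :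
    Polynomial.aeval (diagonal d) f = diagonal fun k => Polynomial.aeval (d k) f := by
  have h := Polynomial.aeval_algHom_apply (diagonalAlgHom K (α := A) (n := ι)) d f
  simp only [diagonalAlgHom_apply] at h
  rw [h]
  congr 1
  ext1 k
  exact aeval_pi_apply d f k

theorem aeval_mem_of_mem {K A : Type*} [Field K] [Ring A] [Algebra K A] (B : Subalgebra K A)
    {a : A} (ha : a ∈ B) (f : Polynomial K) : Polynomial.aeval a f ∈ B :=
  Algebra.adjoin_le (Set.singleton_subset_iff.2 ha)
    (Polynomial.aeval_mem_adjoin_singleton K a)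

/-- A subalgebra of a matrix algebra which contains a diagonal matrix with distinct eigenvalues
and a matrix without zero entries is everything. -/
theorem subalgebra_eq_top_of_diagonal {ι K : Type*} [Field K] [Fintype ι] [DecidableEq ι]
    (B : Subalgebra K (Matrix ι ι K)) {c : ι → K} (hc : Function.Injective c)
    (hcB : diagonal c ∈ B) {q : Matrix ι ι K} (hq : ∀ i j, q i j ≠ 0) (hqB : q ∈ B) : B = ⊤ := by
  have h1 : ∀ i, single i i (1 : K) ∈ B := by
    intro i
    have h : Polynomial.aeval (diagonal c) (Lagrange.basis Finset.univ c i) =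
        single i i (1 : K) := by
      rw [aeval_diagonal, ← diagonal_single]
      congr 1
      ext1 k
      rw [Polynomial.coe_aeval_eq_eval]
      by_cases hk : i = k
      · rw [← hk, Lagrange.eval_basis_self hc.injOn (Finset.mem_univ _), Pi.single_eq_same]
      · rw [Lagrange.eval_basis_of_ne hk (Finset.mem_univ _), Pi.single_eq_of_ne' hk]
    rw [← h]
    exact aeval_mem_of_mem B hcB _
  have h2 : ∀ i j (a : K), single i j a ∈ B := by
    intro i j a
    have h : single i j a = (a * (q i j)⁻¹) • (single i i 1 * q * single j j 1) := by
      rw [single_mul_mul_single, one_mul, mul_one, smul_single, smul_eq_mul, mul_assoc,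
        inv_mul_cancel₀ (hq i j), mul_one]
    rw [h]
    exact B.smul_mem (mul_mem (mul_mem (h1 i) hqB) (h1 j)) _
  refine eq_top_iff.2 fun M _ => ?_
  rw [matrix_eq_sum_single M]
  exact sum_mem fun i _ => sum_mem fun j _ => h2 i j _

theorem blockMonomial_refl {S : Type*} [Semiring S] (d : Fin 5 → S) :
    blockMonomial d 1 = diagonal d := by
  ext1 k l
  by_cases h : k = l
  · rw [← h, diagonal_apply_eq, blockMonomial_eq _ (by rfl)]
  · rw [diagonal_apply_ne _ h, blockMonomial_ne _ h]

theorem single_mul_blockMonomial {S : Type*} [Semiring S] (k l l' : Fin 5) (a : S)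
    (d : Fin 5 → S) (π : Equiv.Perm (Fin 5)) (h : π l = l') :
    single k l a * blockMonomial d π = single k l' (a * d l) := by
  ext i j
  by_cases hi : i = k
  · subst hi
    rw [single_mul_apply_same]
    by_cases hj : l' = j
    · subst hj
      rw [blockMonomial_eq _ h, single_apply_same]
    · rw [blockMonomial_ne _ (h ▸ hj), single_apply_of_col_ne _ _ hj, mul_zero]
  · rw [single_mul_apply_of_ne _ _ _ _ _ hi, single_apply_of_row_ne (Ne.symm hi)]

theorem blockMonomial_mul_single {S : Type*} [Semiring S] (k k' l : Fin 5) (a : S)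
    (d : Fin 5 → S) (π : Equiv.Perm (Fin 5)) (h : π k' = k) :
    blockMonomial d π * single k l a = single k' l (d k' * a) := by
  ext i j
  by_cases hj : j = l
  · subst hj
    rw [mul_single_apply_same]
    by_cases hi : i = k'
    · subst hi
      rw [blockMonomial_eq _ h, single_apply_same]
    · rw [blockMonomial_ne _ (fun h' => hi (π.injective (h'.trans h.symm))),
        single_apply_of_row_ne (Ne.symm hi), zero_mul]
  · rw [mul_single_apply_of_ne _ _ _ _ _ hj, single_apply_of_col_ne _ _ (Ne.symm hj)]

/-- The corner of a subalgebra of block matrices. -/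
def cornerSubalgebra {K A : Type*} [Field K] [Ring A] [Algebra K A]
    (B : Subalgebra K (Matrix (Fin 5) (Fin 5) A)) (h : single 0 0 1 ∈ B) : Subalgebra K A where
  carrier := {a | single 0 0 a ∈ B}
  mul_mem' {a b} ha hb := by
    have : single 0 0 a * single 0 0 b ∈ B := mul_mem ha hb
    rwa [single_mul_single_same] at this
  add_mem' {a b} ha hb := by
    have : single 0 0 a + single 0 0 b ∈ B := add_mem ha hb
    rwa [← single_add] at this
  algebraMap_mem' c := by
    have := B.smul_mem h c
    rwa [smul_single, ← Algebra.algebraMap_eq_smul_one] at this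

variable {m N : ℕ} (hm : Even m) (e : Fin 5 × Fin m ≃ Fin N)

/-- The square of the first generator has block `1` at position 0, and elsewhere conjugates of `x`
or `q`, which do not have the eigenvalue 1. A polynomial in it is therefore the projection to block
0. The generators, their inverses and this projection give the matrix units in row and column 0, and
the corner contains `x` and `q`, which generate it. -/
theorem subalgebra_eq_top_of_monomial {x q : Matrix.SpecialLinearGroup (Fin m) ℂ}
    {c : Fin m → ℂ} (hc : Function.Injective c) (hx : (x : Matrix (Fin m) (Fin m) ℂ) = diagonal c)
    (hx1 : (1 - (x : Matrix (Fin m) (Fin m) ℂ)).det ≠ 0)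
    (hq1 : (1 - (q : Matrix (Fin m) (Fin m) ℂ)).det ≠ 0)
    (hq : ∀ i j, (q : Matrix (Fin m) (Fin m) ℂ) i j ≠ 0)
    (B : Subalgebra ℂ (Matrix (Fin N) (Fin N) ℂ))
    (hU : (monomialU hm e x q : Matrix (Fin N) (Fin N) ℂ) ∈ B)
    (hV : (monomialV hm e x q : Matrix (Fin N) (Fin N) ℂ) ∈ B)
    (hU' : ((monomialU hm e x q)⁻¹ : Matrix.SpecialLinearGroup (Fin N) ℂ).1 ∈ B)
    (hV' : ((monomialV hm e x q)⁻¹ : Matrix.SpecialLinearGroup (Fin N) ℂ).1 ∈ B) : B = ⊤ := by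
  obtain ⟨u0, u1, u2, u3, u4⟩ := permU_apply
  obtain ⟨v0, v1, v2, v3, v4⟩ := permV_apply
  set B' := B.comap (blockEquiv e : _ ≃ₐ[ℂ] Matrix (Fin N) (Fin N) ℂ).toAlgHom with hB'
  have mem : ∀ (d : Fin 5 → Matrix.SpecialLinearGroup (Fin m) ℂ) π, (slMonomial hm e d π : Matrix (Fin N) (Fin N) ℂ) ∈ B →
      blockMonomial (fun k => (d k : Matrix (Fin m) (Fin m) ℂ)) π ∈ B' := fun d π h => h
  rw [monomialU, slMonomial_inv, permU_inv] at hU'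
  rw [monomialV, slMonomial_inv, permV_inv] at hV'
  have bU := mem _ _ hU
  have bV := mem _ _ hV
  have bU' := mem _ _ hU'
  have bV' := mem _ _ hV'
  have bUU : blockMonomial (fun k => ((![1, x, x, x * q * x⁻¹, x * q * x⁻¹] : Fin 5 → _) k :
      Matrix (Fin m) (Fin m) ℂ)) 1 ∈ B' := by
    apply mem
    rw [← monomial_sq_u]
    exact mul_mem hU hU
  have hp1 : (1 - (x * q * x⁻¹ : Matrix.SpecialLinearGroup (Fin m) ℂ).1).det ≠ 0 := by
    have h : 1 - (x * q * x⁻¹ : Matrix.SpecialLinearGroup (Fin m) ℂ).1 =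
        x.1 * (1 - q.1) * (x⁻¹ : Matrix.SpecialLinearGroup (Fin m) ℂ).1 := by
      have h1 : x.1 * (x⁻¹ : Matrix.SpecialLinearGroup (Fin m) ℂ).1 = 1 :=
        congrArg Subtype.val (mul_inv_cancel x)
      rw [mul_sub, mul_one, sub_mul, h1]
      rfl
    rw [h, det_mul, det_mul, x.2, (x⁻¹).2, one_mul, mul_one]
    exact hq1
  have h00 : single 0 0 1 ∈ B' := by
    -- By Cayley-Hamilton `f` kills every block but the first, on which it is the nonzero scalar
    -- `f.eval 1`.
    set f : Polynomial ℂ := x.1.charpoly * q.1.charpoly * (x * q * x⁻¹).1.charpoly with hf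
    have hf1 : f.eval 1 ≠ 0 := by
      rw [hf, Polynomial.eval_mul, Polynomial.eval_mul, eval_charpoly, eval_charpoly,
        eval_charpoly, map_one]
      exact mul_ne_zero (mul_ne_zero hx1 hq1) hp1
    have hx0 : Polynomial.aeval x.1 f = 0 := by
      rw [hf, map_mul, map_mul, aeval_self_charpoly, zero_mul, zero_mul]
    have hp0 : Polynomial.aeval (x * q * x⁻¹).1 f = 0 := by
      rw [hf, map_mul, aeval_self_charpoly, mul_zero]
    have h1 : Polynomial.aeval (1 : Matrix (Fin m) (Fin m) ℂ) f = f.eval 1 • 1 := by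
      have := Polynomial.aeval_algebraMap_apply_eq_algebraMap_eval
        (A := Matrix (Fin m) (Fin m) ℂ) (1 : ℂ) f
      rwa [map_one, Algebra.algebraMap_eq_smul_one] at this
    have h2 : single 0 0 (1 : Matrix (Fin m) (Fin m) ℂ) = (f.eval 1)⁻¹ • Polynomial.aeval
        (blockMonomial (fun k => ((![1, x, x, x * q * x⁻¹, x * q * x⁻¹] : Fin 5 → _) k :
          Matrix (Fin m) (Fin m) ℂ)) 1) f := by
      rw [blockMonomial_refl, aeval_diagonal, ← diagonal_single, ← diagonal_smul]
      congr 1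
      ext1 k
      rw [Pi.smul_apply]
      have h4 : (f.eval 1)⁻¹ • Polynomial.aeval (1 : Matrix (Fin m) (Fin m) ℂ) f = 1 := by
        rw [h1, smul_smul, inv_mul_cancel₀ hf1, one_smul]
      have h5 : (f.eval 1)⁻¹ • Polynomial.aeval x.1 f = 0 := by rw [hx0, smul_zero]
      have h6 : (f.eval 1)⁻¹ • Polynomial.aeval (x * q * x⁻¹).1 f = 0 := by rw [hp0, smul_zero]
      fin_cases k
      exacts [h4.symm, h5.symm, h5.symm, h6.symm, h6.symm]
    rw [h2]
    exact B'.smul_mem (aeval_mem_of_mem B' bUU _) _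
  -- The generators alternately link neighbours on the path 0, 1, 2, 3, 4, and the blocks met in
  -- this direction are all `1`.
  have r1 : single 0 1 1 ∈ B' := by
    simpa [single_mul_blockMonomial _ _ _ _ _ _ v0] using mul_mem h00 bV
  have r2 : single 0 2 1 ∈ B' := by
    simpa [single_mul_blockMonomial _ _ _ _ _ _ u1] using mul_mem r1 bU
  have r3 : single 0 3 1 ∈ B' := by
    simpa [single_mul_blockMonomial _ _ _ _ _ _ v2] using mul_mem r2 bV
  have r4 : single 0 4 1 ∈ B' := by
    simpa [single_mul_blockMonomial _ _ _ _ _ _ u3] using mul_mem r3 bU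
  have c1 : single 1 0 1 ∈ B' := by
    simpa [blockMonomial_mul_single _ _ _ _ _ _ v1, v1] using mul_mem bV' h00
  have c2 : single 2 0 1 ∈ B' := by
    simpa [blockMonomial_mul_single _ _ _ _ _ _ u2, u2] using mul_mem bU' c1
  have c3 : single 3 0 1 ∈ B' := by
    simpa [blockMonomial_mul_single _ _ _ _ _ _ v3, v3] using mul_mem bV' c2
  have c4 : single 4 0 1 ∈ B' := by
    simpa [blockMonomial_mul_single _ _ _ _ _ _ u4, u4] using mul_mem bU' c3
  have hqB : q.1 ∈ cornerSubalgebra B' h00 := by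
    change single 0 0 q.1 ∈ B'
    simpa [single_mul_blockMonomial _ _ _ _ _ _ v1] using mul_mem r1 bV
  have hxB : x.1 ∈ cornerSubalgebra B' h00 := by
    change single 0 0 x.1 ∈ B'
    have h1 : single 0 1 x.1 ∈ B' := by
      simpa [single_mul_blockMonomial _ _ _ _ _ _ u2] using mul_mem r2 bU
    simpa [single_mul_blockMonomial _ _ _ _ _ _ v1, v1] using mul_mem h1 bV'
  rw [hx] at hxB
  have hcorner := subalgebra_eq_top_of_diagonal _ hc hxB hq hqB
  have row : ∀ l, single 0 l 1 ∈ B' := by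
    intro l
    fin_cases l
    exacts [h00, r1, r2, r3, r4]
  have col : ∀ k, single k 0 1 ∈ B' := by
    intro k
    fin_cases k
    exacts [h00, c1, c2, c3, c4]
  have htop : ∀ M, M ∈ B' := by
    intro M
    rw [matrix_eq_sum_single M]
    refine sum_mem fun k _ => sum_mem fun l _ => ?_
    have h1 : single 0 0 (M k l) ∈ B' := by
      change M k l ∈ cornerSubalgebra B' h00
      rw [hcorner]
      trivial
    have h2 := mul_mem (mul_mem (col k) h1) (row l)
    rwa [single_mul_single_same, single_mul_single_same, one_mul, mul_one] at h2
  refine eq_top_iff.2 fun M _ => ?_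
  have := htop ((blockEquiv e).symm M)
  rw [hB', Subalgebra.mem_comap] at this
  simpa using this

end Generation

/-! ### The base point of the family. -/

section BasePoint

open Matrix

theorem det_one_add_constant {m : ℕ} (a : ℂ) :
    (1 + Matrix.of fun _ _ : Fin m => a).det = 1 + m * a := by
  have h : (Matrix.of fun _ _ : Fin m => a) =
      replicateCol Unit (fun _ : Fin m => (1 : ℂ)) * replicateRow Unit (fun _ : Fin m => a) := by
    ext i j
    simp [Matrix.mul_apply]
  rw [h, det_one_add_replicateCol_mul_replicateRow]
  simp [dotProduct]

/-- A diagonal matrix of determinant one with distinct eigenvalues, none of which is one. -/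
theorem exists_diagonal_sl {m : ℕ} (hm : Even m) :
    ∃ (x : Matrix.SpecialLinearGroup (Fin m) ℂ) (c : Fin m → ℂ), Function.Injective c ∧
      (x : Matrix (Fin m) (Fin m) ℂ) = diagonal c ∧
      (1 - (x : Matrix (Fin m) (Fin m) ℂ)).det ≠ 0 := by
  have pow_inj : ∀ {a b : ℕ}, (2 : ℂ) ^ a = 2 ^ b → a = b := by
    intro a b h
    have h' : (2 : ℕ) ^ a = 2 ^ b := by exact_mod_cast h
    exact Nat.pow_right_injective le_rfl h'
  have h2 : (2 : ℂ) ^ m ≠ 0 := pow_ne_zero _ two_ne_zero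
  -- The first `m` odd numbers add up to `m²`, so the product is 1. An odd exponent never equals the
  -- even `m`, so no entry is 1.
  set c : Fin m → ℂ := fun i => 2 ^ (2 * (i : ℕ) + 1) / 2 ^ m with hc
  have hsum : ∀ k : ℕ, ∑ i ∈ Finset.range k, (2 * i + 1) = k * k := by
    intro k
    induction k with
    | zero => rfl
    | succ k ih => rw [Finset.sum_range_succ, ih]; ring
  have hdet : (diagonal c).det = 1 := by
    rw [det_diagonal, hc, Finset.prod_div_distrib, Finset.prod_pow_eq_pow_sum, Finset.prod_const,
      Finset.card_univ, Fintype.card_fin, Fin.sum_univ_eq_sum_range (fun i => 2 * i + 1), hsum,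
      ← pow_mul, div_self (pow_ne_zero _ two_ne_zero)]
  refine ⟨⟨diagonal c, hdet⟩, c, ?_, rfl, ?_⟩
  · intro i j h
    have h1 := pow_inj ((div_left_inj' h2).1 h)
    exact Fin.ext (by omega)
  · change (1 - diagonal c).det ≠ 0
    rw [← diagonal_one, diagonal_sub, det_diagonal]
    refine Finset.prod_ne_zero_iff.2 fun i _ => sub_ne_zero.2 fun h => ?_
    have h1 := pow_inj ((div_eq_one_iff_eq h2).1 h.symm)
    obtain ⟨r, hr⟩ := hm
    omega

/-- A matrix of determinant one without zero entries and without eigenvalue one. -/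
theorem exists_dense_sl {m : ℕ} (hm : Even m) (hm0 : m ≠ 0) :
    ∃ q : Matrix.SpecialLinearGroup (Fin m) ℂ, (∀ i j, (q : Matrix (Fin m) (Fin m) ℂ) i j ≠ 0) ∧
      (1 - (q : Matrix (Fin m) (Fin m) ℂ)).det ≠ 0 := by
  have h2 : (2 : ℂ) ^ m ≠ 0 := pow_ne_zero _ two_ne_zero
  have hmC : (m : ℂ) ≠ 0 := Nat.cast_ne_zero.2 hm0
  -- With `J` the all-ones matrix, `2(1 + aJ)` has determinant `2 ^ m * (1 + m * a)`, and `a` solves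
  -- for the value 1.
  set a : ℂ := ((2 ^ m)⁻¹ - 1) / m with ha
  have hma : m * a = (2 ^ m)⁻¹ - 1 := mul_div_cancel₀ _ hmC
  have hm2 : m < 2 ^ m := Nat.lt_two_pow_self
  obtain ⟨r, hr⟩ := id hm
  have k1 : (2 : ℂ) ^ m ≠ 1 := by
    intro h
    have : 2 ^ m = 1 := by exact_mod_cast h
    omega
  have k2 : (m : ℂ) * 2 ^ m + 1 ≠ 2 ^ m := by
    intro h
    have : m * 2 ^ m + 1 = 2 ^ m := by exact_mod_cast h
    have := Nat.le_mul_of_pos_left (2 ^ m) (Nat.pos_of_ne_zero hm0)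
    omega
  have ha0 : a ≠ 0 := by
    intro h
    rw [h, mul_zero] at hma
    exact k1 (inv_eq_one.1 (sub_eq_zero.1 hma.symm))
  have ha1 : 1 + a ≠ 0 := by
    intro h
    have : a = -1 := by linear_combination h
    rw [this] at hma
    apply k2
    field_simp at hma
    linear_combination -hma
  refine ⟨⟨(2 : ℂ) • (1 + Matrix.of fun _ _ => a), ?_⟩, ?_, ?_⟩
  · rw [det_smul, det_one_add_constant, hma, Fintype.card_fin]
    field_simp
    ring
  · intro i j
    change (2 : ℂ) * ((1 : Matrix (Fin m) (Fin m) ℂ) i j + a) ≠ 0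
    refine mul_ne_zero two_ne_zero ?_
    rw [one_apply]
    split_ifs
    · exact ha1
    · rwa [zero_add]
  · have h : (1 - (2 : ℂ) • (1 + Matrix.of fun _ _ => a) : Matrix (Fin m) (Fin m) ℂ) =
        -(1 + Matrix.of fun _ _ => 2 * a) := by
      ext i j
      simp only [Matrix.sub_apply, Matrix.smul_apply, Matrix.add_apply, of_apply,
        Matrix.neg_apply, smul_eq_mul]
      ring
    change (1 - (2 : ℂ) • (1 + Matrix.of fun _ _ => a) : Matrix (Fin m) (Fin m) ℂ).det ≠ 0
    rw [h, det_neg, det_one_add_constant, Fintype.card_fin, hm.neg_one_pow, one_mul]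
    intro h0
    have h1 : (2 : ℂ) ^ m = 2 := by
      have h3 : 2 * ((2 : ℂ) ^ m)⁻¹ = 1 := by linear_combination h0 - 2 * hma
      field_simp at h3
      exact h3.symm
    have h4 : 2 ^ m = 2 := by exact_mod_cast h1
    have h5 : 2 ^ 2 ≤ 2 ^ m := Nat.pow_le_pow_right two_pos (by omega)
    omega

end BasePoint

/-! ### Directions transversal to conjugation. -/

section Deformations

open Matrix Module

/-- Pairs of traceless matrices which are transversal to the infinitesimal conjugations of
`(x, q)`. -/
theorem exists_transversal {m : ℕ} (hm0 : m ≠ 0) (x q : Matrix.SpecialLinearGroup (Fin m) ℂ) :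
    ∃ X Y : (Fin (m ^ 2 - 1) → ℂ) →ₗ[ℂ] Matrix (Fin m) (Fin m) ℂ,
      (∀ v, (X v).trace = 0) ∧ (∀ v, (Y v).trace = 0) ∧
      ∀ v Z, x.1 * X v = Z * x.1 - x.1 * Z → q.1 * Y v = Z * q.1 - q.1 * Z → v = 0 := by
  let M := Matrix (Fin m) (Fin m) ℂ
  have : NeZero m := ⟨hm0⟩
  let δ : M →ₗ[ℂ] M × M :=
    ((LinearMap.mulRight ℂ x.1 - LinearMap.mulLeft ℂ x.1 : M →ₗ[ℂ] M)).prod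
      (LinearMap.mulRight ℂ q.1 - LinearMap.mulLeft ℂ q.1)
  let τ : M × M →ₗ[ℂ] ℂ × ℂ :=
    (traceLinearMap (Fin m) ℂ ℂ).prodMap (traceLinearMap (Fin m) ℂ ℂ)
  -- Left translation moves tangent vectors at `(x, q)` to the identity, where tangency to SL(m)
  -- means trace zero.
  let ν : M × M →ₗ[ℂ] M × M :=
    (LinearMap.mulLeft ℂ (x⁻¹).1).prodMap (LinearMap.mulLeft ℂ (q⁻¹).1)
  have hM : finrank ℂ M = m ^ 2 := by
    rw [finrank_matrix, Fintype.card_fin, finrank_self, mul_one, sq]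
  have hMM : finrank ℂ (M × M) = 2 * m ^ 2 := by rw [finrank_prod, hM, two_mul]
  have hker : 1 ≤ finrank ℂ (LinearMap.ker δ) := by
    rw [Nat.one_le_iff_ne_zero, ← Nat.pos_iff_ne_zero, finrank_pos_iff_exists_ne_zero]
    refine ⟨⟨1, ?_⟩, ?_⟩
    · rw [LinearMap.mem_ker]
      ext1 <;> simp [δ]
    · intro h
      exact one_ne_zero (congrArg Subtype.val h)
  have hrange := LinearMap.finrank_range_add_finrank_ker δ
  have hτ := LinearMap.finrank_range_add_finrank_ker (τ ∘ₗ ν)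
  have hτr : finrank ℂ (LinearMap.range (τ ∘ₗ ν)) ≤ 2 := by
    refine (Submodule.finrank_le _).trans ?_
    rw [finrank_prod, finrank_self]
  obtain ⟨W, hW⟩ := Submodule.exists_isCompl (LinearMap.range δ)
  have hWd := Submodule.finrank_add_eq_of_isCompl hW
  have hinf := Submodule.finrank_sup_add_finrank_inf_eq W (LinearMap.ker (τ ∘ₗ ν))
  have hsup := Submodule.finrank_le (W ⊔ LinearMap.ker (τ ∘ₗ ν))
  -- Scalars commute with everything, so infinitesimal conjugations have dimension at most `m² - 1`
  -- and `W` at least `m² + 1`; the two trace conditions cost at most 2.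
  have hd : m ^ 2 - 1 ≤ finrank ℂ (W ⊓ LinearMap.ker (τ ∘ₗ ν) : Submodule ℂ (M × M)) := by
    omega
  obtain ⟨f, hf⟩ := exists_linearIndependent_of_le_finrank hd
  have hx : x.1 * (x⁻¹).1 = 1 := congrArg Subtype.val (mul_inv_cancel x)
  have hq : q.1 * (q⁻¹).1 = 1 := congrArg Subtype.val (mul_inv_cancel q)
  let F : (Fin (m ^ 2 - 1) → ℂ) →ₗ[ℂ] (W ⊓ LinearMap.ker (τ ∘ₗ ν) : Submodule ℂ (M × M)) :=
    Fintype.linearCombination ℂ f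
  have hF : Function.Injective F := hf.fintypeLinearCombination_injective
  let F' : (Fin (m ^ 2 - 1) → ℂ) →ₗ[ℂ] M × M := Submodule.subtype _ ∘ₗ F
  have hker' : ∀ v, τ (ν (F' v)) = 0 := fun v => (F v).2.2
  refine ⟨LinearMap.mulLeft ℂ (x⁻¹).1 ∘ₗ LinearMap.fst ℂ M M ∘ₗ F',
    LinearMap.mulLeft ℂ (q⁻¹).1 ∘ₗ LinearMap.snd ℂ M M ∘ₗ F',
    fun v => congrArg Prod.fst (hker' v), fun v => congrArg Prod.snd (hker' v), ?_⟩
  intro v Z h1 h2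
  have h1' : (F' v).1 = Z * x.1 - x.1 * Z := by
    rw [← h1]
    change _ = x.1 * ((x⁻¹).1 * (F' v).1)
    rw [← mul_assoc, hx, one_mul]
  have h2' : (F' v).2 = Z * q.1 - q.1 * Z := by
    rw [← h2]
    change _ = q.1 * ((q⁻¹).1 * (F' v).2)
    rw [← mul_assoc, hq, one_mul]
  have h3 : F' v = δ Z := Prod.ext h1' h2'
  have h4 : F' v = 0 := Submodule.disjoint_def.1 hW.disjoint _ ⟨Z, h3.symm⟩ (F v).2.1
  exact hF ((Subtype.ext h4).trans (map_zero F).symm)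

end Deformations

/-! ### Matrices over the ring of entire functions. -/

section AnalyticFamily

open Matrix

/-- The ring of entire functions of `d` complex variables. -/
def entireFunctions (d : ℕ) : Subalgebra ℂ ((Fin d → ℂ) → ℂ) where
  carrier := {f | ∀ s, AnalyticAt ℂ f s}
  mul_mem' ha hb s := (ha s).mul (hb s)
  add_mem' ha hb s := (ha s).add (hb s)
  algebraMap_mem' _ _ := analyticAt_const

namespace entireFunctions

variable {d m : ℕ}

/-- Evaluation at a point. -/
def eval (s : Fin d → ℂ) : entireFunctions d →ₐ[ℂ] ℂ :=
  (Pi.evalAlgHom ℂ (fun _ => ℂ) s).comp (entireFunctions d).val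

/-- The derivative at the origin in a given direction. -/
noncomputable def deriv (v : Fin d → ℂ) : entireFunctions d →+ ℂ where
  toFun f := fderiv ℂ (f : (Fin d → ℂ) → ℂ) 0 v
  map_zero' := by
    change fderiv ℂ (fun _ => (0 : ℂ)) 0 v = 0
    simp
  map_add' f g := by
    change fderiv ℂ (f.1 + g.1) 0 v = _
    rw [fderiv_add (f.2 0).differentiableAt (g.2 0).differentiableAt]
    rfl

theorem deriv_mul (v : Fin d → ℂ) (f g : entireFunctions d) :
    deriv v (f * g) = eval 0 f * deriv v g + deriv v f * eval 0 g := by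
  change fderiv ℂ (f.1 * g.1) 0 v = f.1 0 * fderiv ℂ g.1 0 v + fderiv ℂ f.1 0 v * g.1 0
  rw [fderiv_mul (f.2 0).differentiableAt (g.2 0).differentiableAt]
  simp [mul_comm]

theorem map_deriv_mul (v : Fin d → ℂ) (A B : Matrix (Fin m) (Fin m) (entireFunctions d)) :
    (A * B).map (deriv v) =
      A.map (eval 0) * B.map (deriv v) + A.map (deriv v) * B.map (eval 0) := by
  ext i j
  simp only [map_apply, Matrix.mul_apply, Matrix.add_apply, map_sum, deriv_mul,
    Finset.sum_add_distrib]

theorem map_eval_mul (s : Fin d → ℂ) (A B : Matrix (Fin m) (Fin m) (entireFunctions d)) :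
    (A * B).map (eval s) = A.map (eval s) * B.map (eval s) :=
  Matrix.map_mul

theorem deriv_algebraMap (v : Fin d → ℂ) (c : ℂ) :
    deriv v (algebraMap ℂ (entireFunctions d) c) = 0 := by
  change fderiv ℂ (fun _ => c) 0 v = 0
  simp

theorem deriv_one (v : Fin d → ℂ) : deriv v (1 : entireFunctions d) = 0 := by
  rw [← map_one (algebraMap ℂ (entireFunctions d)), deriv_algebraMap]

/-- A linear functional as an entire function. -/
noncomputable def ofLinear (f : (Fin d → ℂ) →ₗ[ℂ] ℂ) : entireFunctions d :=
  ⟨f, fun s => (LinearMap.toContinuousLinearMap f).analyticAt s⟩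

theorem eval_ofLinear (f : (Fin d → ℂ) →ₗ[ℂ] ℂ) (s : Fin d → ℂ) : eval s (ofLinear f) = f s := rfl

theorem deriv_ofLinear (f : (Fin d → ℂ) →ₗ[ℂ] ℂ) (v : Fin d → ℂ) : deriv v (ofLinear f) = f v := by
  change fderiv ℂ (LinearMap.toContinuousLinearMap f) 0 v = f v
  rw [ContinuousLinearMap.fderiv]
  rfl

/-- The exponential of a linear functional. -/
noncomputable def expLinear (f : (Fin d → ℂ) →ₗ[ℂ] ℂ) : entireFunctions d :=
  ⟨fun s => Complex.exp (f s), fun s => ((LinearMap.toContinuousLinearMap f).analyticAt s).cexp'⟩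

theorem eval_expLinear (f : (Fin d → ℂ) →ₗ[ℂ] ℂ) (s : Fin d → ℂ) :
    eval s (expLinear f) = Complex.exp (f s) := rfl

theorem deriv_expLinear (f : (Fin d → ℂ) →ₗ[ℂ] ℂ) (v : Fin d → ℂ) :
    deriv v (expLinear f) = f v := by
  change fderiv ℂ (fun s => Complex.exp (LinearMap.toContinuousLinearMap f s)) 0 v = f v
  rw [(LinearMap.toContinuousLinearMap f).hasFDerivAt.cexp.fderiv]
  simp

theorem ext_eval {f g : entireFunctions d} (h : ∀ s, eval s f = eval s g) : f = g :=
  Subtype.ext (funext h)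

/-- The lower triangular unipotent matrix with given entries. -/
noncomputable def lower (A : Fin m → Fin m → (Fin d → ℂ) →ₗ[ℂ] ℂ) :
    Matrix (Fin m) (Fin m) (entireFunctions d) :=
  Matrix.of fun i j => if j < i then ofLinear (A i j) else if i = j then 1 else 0

theorem det_lower (A : Fin m → Fin m → (Fin d → ℂ) →ₗ[ℂ] ℂ) : (lower A).det = 1 := by
  rw [det_of_isLowerTriangular, Finset.prod_eq_one]
  · intro i _
    simp [lower]
  · intro i j hij
    have h : i < j := hij
    simp [lower, h.not_gt, h.ne]

theorem lower_eval_zero (A : Fin m → Fin m → (Fin d → ℂ) →ₗ[ℂ] ℂ) :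
    (lower A).map (eval 0) = 1 := by
  ext i j
  simp only [lower, map_apply, of_apply, one_apply]
  split_ifs with h1 h2
  · exact absurd h2 h1.ne'
  · rw [eval_ofLinear, map_zero]
  · rw [map_one]
  · rw [map_zero]

theorem lower_deriv (A : Fin m → Fin m → (Fin d → ℂ) →ₗ[ℂ] ℂ) (v : Fin d → ℂ) :
    (lower A).map (deriv v) = Matrix.of fun i j => if j < i then A i j v else 0 := by
  ext i j
  simp only [lower, map_apply, of_apply]
  split_ifs with h1 h2
  · rw [deriv_ofLinear]
  · rw [deriv_one]
  · rw [map_zero]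

/-- A diagonal matrix with exponential entries. -/
noncomputable def expDiagonal (A : Fin m → (Fin d → ℂ) →ₗ[ℂ] ℂ) :
    Matrix (Fin m) (Fin m) (entireFunctions d) :=
  diagonal fun i => expLinear (A i)

theorem det_expDiagonal (A : Fin m → (Fin d → ℂ) →ₗ[ℂ] ℂ) (hA : ∀ s, ∑ i, A i s = 0) :
    (expDiagonal A).det = 1 := by
  rw [expDiagonal, det_diagonal]
  refine ext_eval fun s => ?_
  rw [map_prod, map_one]
  simp only [eval_expLinear]
  rw [← Complex.exp_sum, hA, Complex.exp_zero]

theorem expDiagonal_eval_zero (A : Fin m → (Fin d → ℂ) →ₗ[ℂ] ℂ) :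
    (expDiagonal A).map (eval 0) = 1 := by
  rw [expDiagonal, diagonal_map (map_zero _), ← diagonal_one]
  congr 1
  ext1 i
  rw [eval_expLinear, map_zero, Complex.exp_zero]

theorem expDiagonal_deriv (A : Fin m → (Fin d → ℂ) →ₗ[ℂ] ℂ) (v : Fin d → ℂ) :
    (expDiagonal A).map (deriv v) = diagonal fun i => A i v := by
  rw [expDiagonal, diagonal_map (map_zero _)]
  congr 1
  ext1 i
  rw [deriv_expLinear]

/-- A family of matrices of determinant one through the identity with given tangent map. -/
theorem exists_sl_tangent (A : (Fin d → ℂ) →ₗ[ℂ] Matrix (Fin m) (Fin m) ℂ)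
    (hA : ∀ v, (A v).trace = 0) :
    ∃ T : Matrix.SpecialLinearGroup (Fin m) (entireFunctions d),
      T.1.map (eval 0) = 1 ∧ ∀ v, T.1.map (deriv v) = A v := by
  let a : Fin m → Fin m → (Fin d → ℂ) →ₗ[ℂ] ℂ := fun i j => Matrix.entryLinearMap ℂ ℂ i j ∘ₗ A
  -- The family is a product of lower unipotent, diagonal and upper unipotent factors. The upper
  -- factor is built as the transpose of a lower one, hence the swapped indices.
  let b : Fin m → Fin m → (Fin d → ℂ) →ₗ[ℂ] ℂ := fun i j => a j i
  have hL := lower_eval_zero a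
  have hB := lower_eval_zero b
  have hE := expDiagonal_eval_zero fun i => a i i
  have hT : ((lower b)ᵀ).map (eval 0) = 1 := by rw [transpose_map, hB, transpose_one]
  refine ⟨⟨lower a * expDiagonal (fun i => a i i) * (lower b)ᵀ, ?_⟩, ?_, fun v => ?_⟩
  · rw [det_mul, det_mul, det_transpose, det_lower, det_lower, det_expDiagonal _ hA]
    simp
  · change (lower a * expDiagonal (fun i => a i i) * (lower b)ᵀ).map (eval 0) = 1
    rw [map_eval_mul, map_eval_mul, hL, hE, hT, one_mul, one_mul]
  · change (lower a * expDiagonal (fun i => a i i) * (lower b)ᵀ).map (deriv v) = A v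
    rw [map_deriv_mul, map_deriv_mul, map_eval_mul, hL, hE, hT, transpose_map, lower_deriv,
      lower_deriv, expDiagonal_deriv]
    ext i j
    simp only [one_mul, mul_one, Matrix.add_apply, transpose_apply, of_apply, diagonal_apply]
    rcases lt_trichotomy i j with h | h | h
    · simp [h, h.not_gt, h.ne, a, b]
    · simp [h, a]
    · simp [h, h.not_gt, h.ne', a]

/-- A family of matrices of determinant one through a given matrix with given tangent map. -/
theorem exists_sl_family (x : Matrix.SpecialLinearGroup (Fin m) ℂ)
    (A : (Fin d → ℂ) →ₗ[ℂ] Matrix (Fin m) (Fin m) ℂ) (hA : ∀ v, (A v).trace = 0) :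
    ∃ T : Matrix.SpecialLinearGroup (Fin m) (entireFunctions d),
      Matrix.SpecialLinearGroup.map (eval 0 : entireFunctions d →ₐ[ℂ] ℂ).toRingHom T = x ∧
        ∀ v, T.1.map (deriv v) = x.1 * A v := by
  obtain ⟨T, h0, h1⟩ := exists_sl_tangent A hA
  let x' := Matrix.SpecialLinearGroup.map (algebraMap ℂ (entireFunctions d)) x
  have hx0 : x'.1.map (eval 0) = x.1 := by
    ext i j
    exact AlgHom.commutes (eval (0 : Fin d → ℂ)) (x.1 i j)
  have hx1 : ∀ v, x'.1.map (deriv v) = 0 := by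
    intro v
    ext i j
    exact deriv_algebraMap v (x.1 i j)
  refine ⟨x' * T, ?_, fun v => ?_⟩
  · apply Subtype.ext
    change (x'.1 * T.1).map (eval 0) = x.1
    rw [map_eval_mul, h0, hx0, mul_one]
  · change (x'.1 * T.1).map (deriv v) = x.1 * A v
    rw [map_deriv_mul, hx0, hx1, h1, zero_mul, add_zero]

end entireFunctions

end AnalyticFamily

/-! ### The induced family and the conclusion. -/

section InducedFamily

open Matrix entireFunctions

theorem map_monomialU {m N : ℕ} (hm : Even m) (e : Fin 5 × Fin m ≃ Fin N) {R R' : Type*}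
    [CommRing R] [CommRing R'] (f : R →+* R') (x q : Matrix.SpecialLinearGroup (Fin m) R) :
    Matrix.SpecialLinearGroup.map f (monomialU hm e x q) =
      monomialU hm e (Matrix.SpecialLinearGroup.map f x) (Matrix.SpecialLinearGroup.map f q) := by
  rw [monomialU, slMonomial_map]
  apply slMonomial_congr <;> simp

theorem map_monomialV {m N : ℕ} (hm : Even m) (e : Fin 5 × Fin m ≃ Fin N) {R R' : Type*}
    [CommRing R] [CommRing R'] (f : R →+* R') (x q : Matrix.SpecialLinearGroup (Fin m) R) :
    Matrix.SpecialLinearGroup.map f (monomialV hm e x q) =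
      monomialV hm e (Matrix.SpecialLinearGroup.map f x) (Matrix.SpecialLinearGroup.map f q) := by
  rw [monomialV, slMonomial_map]
  apply slMonomial_congr <;> simp

/-- The derivative of a family of block diagonal matrices that is tangent to a conjugation. -/
theorem corner_of_tangent {m N d : ℕ} (hm : Even m) (e : Fin 5 × Fin m ≃ Fin N)
    (D : Fin 5 → Matrix.SpecialLinearGroup (Fin m) (entireFunctions d)) (v : Fin d → ℂ)
    (X : Matrix (Fin N) (Fin N) ℂ)
    (h : (slMonomial hm e D 1).1.map (deriv v) =
      X * (slMonomial hm e D 1).1.map (eval 0) - (slMonomial hm e D 1).1.map (eval 0) * X) :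
    (D 0).1.map (deriv v) = (blockEquiv e).symm X 0 0 * (D 0).1.map (eval 0) -
      (D 0).1.map (eval 0) * (blockEquiv e).symm X 0 0 := by
  obtain ⟨Y, rfl⟩ := (blockEquiv e (R := ℂ)).surjective X
  rw [AlgEquiv.symm_apply_apply]
  have h0 : (slMonomial hm e D 1).1.map (eval 0) =
      blockEquiv e (diagonal fun k => (D k).1.map (eval 0)) := by
    have := slMonomial_map hm e (eval (0 : Fin d → ℂ)).toRingHom D 1
    rw [← blockMonomial_refl]
    exact congrArg Subtype.val this
  rw [h0, ← map_mul, ← map_mul, ← map_sub] at h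
  ext i j
  have h1 := congr_fun (congr_fun h (e (0, i))) (e (0, j))
  rw [blockEquiv_apply, Matrix.sub_apply, mul_diagonal, diagonal_mul] at h1
  rw [← h1, map_apply, map_apply]
  congr 1
  change _ = blockEquiv e _ _ _
  rw [blockEquiv_apply, blockMonomial_eq _ (by rfl)]

/-- A family of representations of a group with the two generator images of the figure-eight knot
group, transversal to conjugation. -/
theorem exists_component_of_homs {G : Type} [Group G] (n : ℕ) (hn : 1 ≤ n)
    (hG : ∀ {Γ : Type} [Group Γ] (U V : Γ), V * U * V⁻¹ * U * V = U * V * U⁻¹ * V * U →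
      ∃ φ : G →* Γ, U ∈ φ.range ∧ V ∈ φ.range) :
    ∃ C ∈ irreducibleComponents (CharacterVariety G (10 * n)),
      ((4 * n ^ 2 - 1 : ℕ) : WithBot ℕ∞) ≤ topologicalKrullDim C ∧
        ∃ ρ : SLRep G (10 * n), ρ.Irreducible ∧ ρ.character ∈ C := by
  have hm : Even (2 * n) := even_two_mul n
  have hm0 : 2 * n ≠ 0 := by omega
  have : NeZero (10 * n) := ⟨by omega⟩
  let e : Fin 5 × Fin (2 * n) ≃ Fin (10 * n) := finProdFinEquiv.trans (finCongr (by ring))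
  obtain ⟨x₀, c, hc, hx, hx1⟩ := exists_diagonal_sl hm
  obtain ⟨q₀, hq, hq1⟩ := exists_dense_sl hm hm0
  have hdim : (2 * n) ^ 2 - 1 = 4 * n ^ 2 - 1 := by rw [mul_pow]; rfl
  obtain ⟨X, Y, hX, hY, hXY⟩ := exists_transversal hm0 x₀ q₀
  rw [← hdim]
  obtain ⟨x, hx0, hxv⟩ := exists_sl_family x₀ X hX
  obtain ⟨q, hq0, hqv⟩ := exists_sl_family q₀ Y hY
  -- One homomorphism into matrices of entire functions is an analytic family of representations:
  -- evaluating at `s` gives its members, and analyticity of the entries is automatic.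
  obtain ⟨φ, ⟨gU, hgU⟩, ⟨gV, hgV⟩⟩ := hG (monomialU hm e x q) (monomialV hm e x q)
    (monomial_relation hm e x q)
  let σ : (Fin ((2 * n) ^ 2 - 1) → ℂ) → SLRep G (10 * n) := fun s =>
    (Matrix.SpecialLinearGroup.map (eval s).toRingHom).comp φ
  have hx0' : x.1.map (eval 0) = x₀.1 := congrArg Subtype.val hx0
  have hq0' : q.1.map (eval 0) = q₀.1 := congrArg Subtype.val hq0
  refine exists_component_of_tangent σ (fun g i j => ((φ g).1 i j).2) ?_ ?_
  · let f : G →* Matrix (Fin (10 * n)) (Fin (10 * n)) ℂ :=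
      Matrix.SpecialLinearGroup.coeMonoidHom.comp (σ 0)
    have hU : σ 0 gU = monomialU hm e x₀ q₀ := by
      rw [← hx0, ← hq0, ← map_monomialU, ← hgU]
      rfl
    have hV : σ 0 gV = monomialV hm e x₀ q₀ := by
      rw [← hx0, ← hq0, ← map_monomialV, ← hgV]
      rfl
    have hmem : ∀ g, (σ 0 g).1 ∈ Algebra.adjoin ℂ (Set.range f) := fun g =>
      Algebra.subset_adjoin ⟨g, rfl⟩
    have htop : Algebra.adjoin ℂ (Set.range f) = ⊤ := by
      refine subalgebra_eq_top_of_monomial hm e hc hx hx1 hq1 hq _ ?_ ?_ ?_ ?_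
      · rw [← hU]
        exact hmem gU
      · rw [← hV]
        exact hmem gV
      · rw [← hU, ← map_inv]
        exact hmem gU⁻¹
      · rw [← hV, ← map_inv]
        exact hmem gV⁻¹
    -- The image is already closed under products, so the algebra it generates is its linear span.
    have hspan := Algebra.adjoin_eq_span (R := ℂ) (s := Set.range f)
    rw [htop, ← MonoidHom.coe_mrange, Submonoid.closure_eq, Algebra.top_toSubmodule] at hspan
    exact hspan.symm
  · intro v Z hZ
    have hZ' : ∀ g, (φ g).1.map (deriv v) =
        Z * (φ g).1.map (eval 0) - (φ g).1.map (eval 0) * Z := hZ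
    -- These two elements have block diagonal images with corners `x` and `q`. The corner of `Z`
    -- then acts on `(x₀, q₀)` as an infinitesimal conjugation tangent to `v`, against
    -- transversality.
    have h1 := hZ' (gV * (gU * gU) * gV⁻¹)
    have h2 := hZ' (gV * gV)
    rw [map_mul, map_mul, map_mul, map_inv, hgU, hgV, monomial_conj_sq_u] at h1
    rw [map_mul, hgV, monomial_sq_v] at h2
    have h1' := corner_of_tangent hm e _ v Z h1
    have h2' := corner_of_tangent hm e _ v Z h2
    simp only [cons_val_zero, hxv, hqv, hx0', hq0'] at h1' h2'
    exact hXY v _ h1' h2'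

end InducedFamily

theorem corollary1p3 (K : Set ThreeSphere) (hK : IsFigureEightKnot K) (x : ↥(Kᶜ))
    (n : ℕ) (hn : 1 ≤ n) :
    ∃ C ∈ irreducibleComponents (CharacterVariety (KnotGroup K x) (10 * n)),
      ((4 * n ^ 2 - 1 : ℕ) : WithBot ℕ∞) ≤ topologicalKrullDim C ∧
        ∃ ρ : SLRep (KnotGroup K x) (10 * n), ρ.Irreducible ∧ ρ.character ∈ C :=
  exists_component_of_homs n hn fun U V hUV => hK.exists_hom x U V hUV
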